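/- Let $d\ge 1$, let $\Omega\subset\mathbb C^d$ be open, and let $\mathcal H(\Omega)$ be the Fréchet space of holomorphic functions $f:\Omega\to\mathbb C$ with the topology of uniform convergence on compact subsets of $\Omega$. For $\alpha>0$ let $\mathcal E(\alpha)$ be the set of complex sequences $(x_n)_{n\ge1}$ such that $\sup_{n\ge1}|x_n|\exp(an^{\alpha})<\infty$ for some $a>0$. Let $L:\mathcal H(\Omega)\to\mathcal H(\Omega)$ be a bounded linear operator, that is, a linear operator that maps some neighbourhood of $0$ to a bounded set. Then: (i) There exist a sequence $(s_k)_{k\ge1}$ of positive numbers in $\mathcal E(1/d)$, an equicontinuous sequence $(f_k')_{k\ge1}$ in the topological dual $\mathcal H(\Omega)'$, and a bounded sequence $(f_k)_{k\ge1}$ in $\mathcal H(\Omega)$ such that $$Lf=\sum_{k=1}^\infty s_k\langle f,f_k'\rangle f_k\qquad\text{for all } f\in\mathcal H(\Omega),$$ where $\langle f,f'\rangle$ denotes the value of $f'$ at $f$ and the series converges unconditionally in $\mathcal H(\Omega)$. (ii) Every nonzero eigenvalue $\mu$ of $L$ has finite algebraic multiplicity $\dim\bigcup_{k\ge 1}\ker(L-\mu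 I)^k$, and the nonzero eigenvalues, each repeated according to its algebraic multiplicity, can be arranged in a sequence $(\lambda_n(L))_{n\ge1}$ with $|\lambda_1(L)|\ge|\lambda_2(L)|\ge\cdots$ (padded by zeros if there are only finitely many). Every such sequence belongs to $\mathcal E(1/d)$, that is, $|\lambda_n(L)|=O(e^{-an^{1/d}})$ as $n\to\infty$ for some $a>0$. -/

import Mathlib

open TopologicalSpace Topology Bornology

/-- The space `𝓗(Ω)` of holomorphic functions on an open set `Ω ⊆ ℂ^d`, as a subspace of the space
`C(Ω, ℂ)` of continuous functions. The topology of `C(Ω, ℂ)` in Mathlib is the compact-open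
topology, that is, the topology of uniform convergence on compact subsets of `Ω`, and `𝓗(Ω)` carries
the induced topology. A function on `Ω` is holomorphic if it is the restriction to `Ω` of a function
that is complex differentiable at all points of `Ω`. -/
def HolomorphicSpace {d : ℕ} (Ω : Opens (Fin d → ℂ)) : Submodule ℂ C(Ω, ℂ) where
  carrier := {f | ∃ F : (Fin d → ℂ) → ℂ, DifferentiableOn ℂ F (Ω : Set (Fin d → ℂ)) ∧
    ∀ z : Ω, f z = F z}
  add_mem' := by
    rintro f g ⟨F, hF, hf⟩ ⟨G, hG, hg⟩
    exact ⟨F + G, hF.add hG, fun z => by simp [hf, hg]⟩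
  zero_mem' := ⟨0, differentiableOn_const 0, fun z => by simp⟩
  smul_mem' := by
    rintro c f ⟨F, hF, hf⟩
    exact ⟨c • F, hF.const_smul c, fun z => by simp [hf]⟩

/-- A linear operator on a topological vector space is bounded if it maps some neighbourhood of `0`
to a (von Neumann) bounded set. This is stronger than continuity. -/
def IsBoundedOperator {E : Type*} [AddCommGroup E] [Module ℂ E] [TopologicalSpace E]
    (L : E →ₗ[ℂ] E) : Prop :=
  ∃ U ∈ 𝓝 (0 : E), IsVonNBounded ℂ (L '' U)

/-- The class `𝓔(a, α)` of complex sequences `(xₙ)`, `n = 1, 2, …`, such that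
`supₙ |xₙ| exp (a n ^ α) < ∞`. The term `xₙ` is `x (n - 1)` in the code. -/
def ExpClassOfType (a α : ℝ) : Set (ℕ → ℂ) :=
  {x | BddAbove (Set.range fun n : ℕ => ‖x n‖ * Real.exp (a * ((n : ℝ) + 1) ^ α))}

/-- The class `𝓔(α)`, the union of the classes `𝓔(a, α)` over all `a > 0`. -/
def ExpClass (α : ℝ) : Set (ℕ → ℂ) :=
  ⋃ a ∈ Set.Ioi (0 : ℝ), ExpClassOfType a α

/-- `ev` is the eigenvalue sequence of the linear operator `L`: it is ordered by decreasing modulus,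
and every nonzero complex number `μ` occurs in it exactly as often as its algebraic multiplicity,
the dimension of `⋃ₖ ker (L - μ)ᵏ`, says (in particular this multiplicity is finite, and it is `0`
if `μ` is not an eigenvalue). All remaining terms are `0`, so that the sequence
is padded by zeros if there are only finitely many nonzero eigenvalues. -/
structure IsEigenvalueSequence {E : Type*} [AddCommGroup E] [Module ℂ E]
    (L : E →ₗ[ℂ] E) (ev : ℕ → ℂ) : Prop where
  antitone_norm : Antitone fun n => ‖ev n‖
  finiteDimensional : ∀ μ : ℂ, μ ≠ 0 →
    FiniteDimensional ℂ (Module.End.maxGenEigenspace L μ)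
  encard_eq : ∀ μ : ℂ, μ ≠ 0 →
    {n | ev n = μ}.encard = Module.finrank ℂ (Module.End.maxGenEigenspace L μ)

/-!
A bounded operator `L` on `𝓗(Ω)` only sees the values of a function on a compact set `K ⊆ Ω`: it is
bounded on `{f | sup_K |f| < ε}`. Cover `K` by finitely many polydiscs whose concentric enlargements
by a factor `4` stay in `Ω`. The Taylor coefficients of `f` at the centres, scaled to the large
polydiscs, are equicontinuous functionals `φ`, and on `K` the series converges like `4 ^ (-|β|)`.
Hence `sup_K |f|` is controlled by the `ℓ²` norm of `T f = (2 ^ (-|β|) φ_β f)`, and `L` factors as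
`M ∘ T` with `M` defined on the range of `T`. Since `𝓗(Ω)` is complete, `M` extends to the closure
of the range, and the orthogonal projection extends it to all of `ℓ²`
(`exists_hasSum_of_isVonNBounded_image`). Applying `M` to the unit vectors gives the series for `L`
with coefficients `2 ^ (-|β|)`; as about `m ^ d` multi-indices have `|β| ≤ m`, these decay like
`exp (-a * k ^ (1 / d))` when enumerated (`exists_hasSum_exp`).

For the eigenvalues no Hilbert space is needed. On a finite-dimensional invariant subspace of
dimension `n` on which `L` is injective, consider the minors of the matrix of the functionals `φ k`
against a basis. Inserting the series for `L` and expanding by multilinearity expresses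
`det L` times a minor as a combination of minors over injective choices of `n` terms of the series.
Taking the supremum over all minors bounds `det L` by `Q ^ n * exp (-b * n ^ (1 / d)) ^ n`
for constants `Q` and `b > 0` (`norm_det_le_of_hasSum`). If all eigenvalues on the subspace have
modulus at least `ε`, then `ε ^ n ≤ |det L|`, so that `ε ≤ Q * exp (-b * n ^ (1 / d))`
(`HasSmallEigenvalues`). Applied to subspaces of one generalized eigenspace, and to sums of several,
this yields the finiteness of the multiplicities, the existence of the ordered eigenvalue sequence
and its decay.
-/

/-! ### Determinants and invariant subspaces -/

/-- An injective family of natural numbers can only decrease a product of antitone factors: its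
entries, sorted, dominate `0, 1, …, n - 1`. -/
theorem prod_le_prod_range_of_injective {u : ℕ → ℝ} (hu0 : ∀ l, 0 ≤ u l) (hu : Antitone u)
    {n : ℕ} {r : Fin n → ℕ} (hr : Function.Injective r) :
    ∏ i, u (r i) ≤ ∏ k ∈ Finset.range n, u k := by
  have key : ∀ (n : ℕ) (S : Finset ℕ), S.card = n → ∏ k ∈ S, u k ≤ ∏ k ∈ Finset.range n, u k := by
    intro n
    induction n with
    | zero => intro S hS; rw [Finset.card_eq_zero] at hS; simp [hS]
    | succ n ih =>
      intro S hS
      have hne : S.Nonempty := Finset.card_pos.1 (by omega)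
      have hM := S.max'_mem hne
      have hcard : (S.erase (S.max' hne)).card = n := by
        rw [Finset.card_erase_of_mem hM, hS]; rfl
      have hle : n ≤ S.max' hne := by
        have : S ⊆ Finset.range (S.max' hne + 1) := fun x hx =>
          Finset.mem_range.2 (Nat.lt_succ_of_le (S.le_max' x hx))
        have := Finset.card_le_card this
        rw [Finset.card_range] at this
        omega
      rw [← Finset.prod_erase_mul S u hM, Finset.prod_range_succ]
      exact mul_le_mul (ih _ hcard) (hu hle) (hu0 _) (Finset.prod_nonneg fun _ _ => hu0 _)
  have h := key n (Finset.univ.map ⟨r, hr⟩) (by simp)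
  simpa using h

/-- Let the functionals `φ k` separate points, be pointwise bounded, and satisfy
`φ k ∘ T = ∑ₗ w k l φ l`. In a basis of `E`, the minors of `φ ∘ T` are `det T` times the minors of
`φ`; by multilinearity they are also combinations of minors of `φ`, over injective choices of rows
only. Taking the supremum over all minors of `φ` bounds `det T`. The coefficients are at most
`C * u l ^ 2`: one factor `u l` makes the sum over all choices converge, the other gives the decay
in the dimension. -/
theorem norm_det_le_of_hasSum {E : Type*} [AddCommGroup E] [Module ℂ E] [FiniteDimensional ℂ E]
    (T : E →ₗ[ℂ] E) (φ : ℕ → E →ₗ[ℂ] ℂ) (w : ℕ → ℕ → ℂ) (u : ℕ → ℝ) (C : ℝ) (hC : 0 ≤ C)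
    (hu0 : ∀ l, 0 ≤ u l) (hu : Antitone u) (hus : Summable u)
    (hw : ∀ k l, ‖w k l‖ ≤ C * u l ^ 2)
    (hsum : ∀ k g, HasSum (fun l => w k l * φ l g) (φ k (T g)))
    (hbdd : ∀ g, ∃ B : ℝ, ∀ k, ‖φ k g‖ ≤ B)
    (hsep : ∀ g, (∀ k, φ k g = 0) → g = 0) :
    ‖LinearMap.det T‖ ≤ (C * ∑' l, u l) ^ Module.finrank ℂ E *
      ∏ k ∈ Finset.range (Module.finrank ℂ E), u k := by
  set n := Module.finrank ℂ E with hn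
  let g : Module.Basis (Fin n) ℂ E := Module.finBasis ℂ E
  let X : ℕ → Fin n → ℂ := fun k b => φ k (g b)
  let D : (Fin n → ℕ) → ℂ := fun K => Matrix.det (Matrix.of fun i => X (K i))
  set β : ℝ := (C * ∑' l, u l) ^ n * ∏ k ∈ Finset.range n, u k with hβ
  have hS : 0 ≤ ∑' l, u l := tsum_nonneg hu0
  -- the minors are bounded
  obtain ⟨δ', hδ'⟩ : ∃ δ', ∀ K, ‖D K‖ ≤ δ' := by
    choose B hB using hbdd
    refine ⟨∑ _σ : Equiv.Perm (Fin n), ∏ b, B (g b), fun K => ?_⟩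
    simp only [D, Matrix.det_apply]
    refine (norm_sum_le _ _).trans (Finset.sum_le_sum fun σ _ => ?_)
    have h1 : ∀ (z : ℤˣ) (x : ℂ), ‖z • x‖ = ‖x‖ := by
      intro z x
      rcases Int.units_eq_one_or z with rfl | rfl <;> simp [Units.smul_def]
    rw [h1, norm_prod]
    exact Finset.prod_le_prod (fun _ _ => norm_nonneg _) fun b _ => hB _ _
  -- some minor does not vanish
  obtain ⟨K₀, hK₀⟩ : ∃ K, D K ≠ 0 := by
    have hspan : Submodule.span ℂ (Set.range X) = ⊤ := by
      by_contra hne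
      obtain ⟨f, hf0, hf⟩ := Submodule.exists_le_ker_of_lt_top _ (lt_top_iff_ne_top.2 hne)
      apply hf0
      have hv : (∑ b, f (Pi.single b 1) • g b) = 0 := by
        apply hsep
        intro k
        have h1 : f (X k) = 0 := hf (Submodule.subset_span ⟨k, rfl⟩)
        rw [LinearMap.pi_apply_eq_sum_univ f (X k)] at h1
        rw [map_sum, ← h1]
        refine Finset.sum_congr rfl fun b _ => ?_
        rw [map_smul, smul_eq_mul, smul_eq_mul, mul_comm]
        congr 2
        ext j
        simp [Pi.single_apply, eq_comm]
      have h2 := (Fintype.linearIndependent_iff.1 g.linearIndependent) _ hv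
      ext b
      simpa using h2 b
    obtain ⟨F, hF, -, hFl⟩ := Submodule.exists_fun_fin_finrank_span_eq ℂ (Set.range X)
    have hfr : Module.finrank ℂ (Submodule.span ℂ (Set.range X)) = n := by
      rw [hspan, finrank_top, Module.finrank_fin_fun]
    choose K hK using hF
    refine ⟨fun i => K (Fin.cast hfr.symm i), ?_⟩
    have hli : LinearIndependent ℂ (fun i => X (K (Fin.cast hfr.symm i))) := by
      have : (fun i => X (K (Fin.cast hfr.symm i))) = F ∘ Fin.cast hfr.symm := by
        ext i; simp [hK]
      rw [this]
      exact hFl.comp _ (Fin.cast_injective _)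
    have := (Matrix.linearIndependent_rows_iff_isUnit
      (A := Matrix.of fun i => X (K (Fin.cast hfr.symm i)))).1 hli
    exact ((Matrix.isUnit_iff_isUnit_det _).1 this).ne_zero
  have hbd : BddAbove (Set.range fun K => ‖D K‖) := ⟨δ', by rintro _ ⟨K, rfl⟩; exact hδ' K⟩
  set δ : ℝ := ⨆ K, ‖D K‖ with hδ
  have hDδ : ∀ K, ‖D K‖ ≤ δ := fun K => le_ciSup hbd K
  have hδpos : 0 < δ := lt_of_lt_of_le (norm_pos_iff.2 hK₀) (hDδ K₀)
  -- the expansion of a minor of `φ ∘ T`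
  have hkey : ∀ K, ‖D K‖ * ‖LinearMap.det T‖ ≤ β * δ := by
    intro K
    have hdet : D K * LinearMap.det T = Matrix.det (Matrix.of fun i b => φ (K i) (T (g b))) := by
      rw [← LinearMap.det_toMatrix g T, ← Matrix.det_mul]
      congr 1
      ext i b
      have h := congrArg (φ (K i)) (g.sum_repr (T (g b)))
      simp only [map_sum, map_smul, smul_eq_mul] at h
      simp [Matrix.mul_apply, LinearMap.toMatrix_apply, X, ← h, mul_comm]
    have hlim : Filter.Tendsto (fun N => Matrix.det (Matrix.of fun i =>
        ∑ l ∈ Finset.range N, w (K i) l • X l)) Filter.atTop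
        (𝓝 (Matrix.det (Matrix.of fun i b => φ (K i) (T (g b))))) := by
      refine ((Continuous.matrix_det continuous_id).tendsto _).comp ?_
      refine tendsto_pi_nhds.2 fun i => tendsto_pi_nhds.2 fun b => ?_
      have := (hsum (K i) (g b)).tendsto_sum_nat
      simpa [X] using this
    rw [← norm_mul, hdet]
    refine le_of_tendsto hlim.norm (Filter.Eventually.of_forall fun N => ?_)
    have hexp : Matrix.det (Matrix.of fun i => ∑ l ∈ Finset.range N, w (K i) l • X l) =
        ∑ r ∈ Fintype.piFinset (fun _ : Fin n => Finset.range N),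
          (∏ i, w (K i) (r i)) * D r := by
      have h1 := (Matrix.detRowAlternating (n := Fin n) (R := ℂ)).toMultilinearMap.map_sum_finset
        (fun i l => w (K i) l • X l) (fun _ => Finset.range N)
      refine h1.trans (Finset.sum_congr rfl fun r _ => ?_)
      exact (Matrix.detRowAlternating (n := Fin n) (R := ℂ)).toMultilinearMap.map_smul_univ
        (fun i => w (K i) (r i)) (fun i => X (r i))
    rw [hexp]
    calc ‖∑ r ∈ Fintype.piFinset (fun _ : Fin n => Finset.range N), (∏ i, w (K i) (r i)) * D r‖
        ≤ ∑ r ∈ Fintype.piFinset (fun _ : Fin n => Finset.range N),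
          (∏ i, C * u (r i)) * ((∏ k ∈ Finset.range n, u k) * δ) := by
          refine (norm_sum_le _ _).trans (Finset.sum_le_sum fun r _ => ?_)
          by_cases hr : Function.Injective r
          · rw [norm_mul, norm_prod, ← mul_assoc]
            refine mul_le_mul ?_ (hDδ r) (norm_nonneg _) (mul_nonneg
              (Finset.prod_nonneg fun _ _ => mul_nonneg hC (hu0 _))
              (Finset.prod_nonneg fun _ _ => hu0 _))
            calc ∏ i, ‖w (K i) (r i)‖ ≤ ∏ i, (C * u (r i)) * u (r i) :=
                  Finset.prod_le_prod (fun _ _ => norm_nonneg _) fun i _ =>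
                    (hw _ _).trans_eq (by ring)
              _ = (∏ i, C * u (r i)) * ∏ i, u (r i) := Finset.prod_mul_distrib
              _ ≤ _ := mul_le_mul_of_nonneg_left (prod_le_prod_range_of_injective hu0 hu hr)
                  (Finset.prod_nonneg fun _ _ => mul_nonneg hC (hu0 _))
          · have hD0 : D r = 0 := by
              simp only [Function.Injective, not_forall] at hr
              obtain ⟨i, j, hij, hne⟩ := hr
              exact Matrix.det_zero_of_row_eq hne (by ext b; simp [hij])
            rw [hD0, mul_zero, norm_zero]
            exact mul_nonneg (Finset.prod_nonneg fun _ _ => mul_nonneg hC (hu0 _))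
              (mul_nonneg (Finset.prod_nonneg fun _ _ => hu0 _) hδpos.le)
      _ = (∏ _i : Fin n, ∑ l ∈ Finset.range N, C * u l) *
            ((∏ k ∈ Finset.range n, u k) * δ) := by
          rw [Finset.prod_univ_sum, Finset.sum_mul]
      _ ≤ (C * ∑' l, u l) ^ n * ((∏ k ∈ Finset.range n, u k) * δ) := by
          refine mul_le_mul_of_nonneg_right ?_
            (mul_nonneg (Finset.prod_nonneg fun _ _ => hu0 _) hδpos.le)
          rw [Finset.prod_const, Finset.card_univ, Fintype.card_fin, ← Finset.mul_sum]
          exact pow_le_pow_left₀ (mul_nonneg hC (Finset.sum_nonneg fun _ _ => hu0 _))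
            (mul_le_mul_of_nonneg_left (hus.sum_le_tsum _ fun _ _ => hu0 _) hC) n
      _ = β * δ := by rw [hβ]; ring
  have h3 : δ * ‖LinearMap.det T‖ ≤ β * δ := by
    rw [hδ, Real.iSup_mul_of_nonneg (norm_nonneg _)]
    exact ciSup_le hkey
  nlinarith

/-- The determinant is the product of the eigenvalues, with multiplicities. -/
theorem pow_finrank_le_norm_det {E : Type*} [AddCommGroup E] [Module ℂ E] [FiniteDimensional ℂ E]
    (T : E →ₗ[ℂ] E) {ε : ℝ} (hε : 0 ≤ ε)
    (h : ∀ μ : ℂ, Module.End.HasEigenvalue T μ → ε ≤ ‖μ‖) :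
    ε ^ Module.finrank ℂ E ≤ ‖LinearMap.det T‖ := by
  have hs := IsAlgClosed.splits (LinearMap.charpoly T)
  rw [Module.End.det_eq_prod_roots_charpoly_of_splits hs, ← LinearMap.charpoly_natDegree T,
    hs.natDegree_eq_card_roots]
  have h' : ∀ μ ∈ T.charpoly.roots, ε ≤ ‖μ‖ := fun μ hμ => h μ
    ((Module.End.hasEigenvalue_iff_isRoot_charpoly T μ).2 (Polynomial.isRoot_of_mem_roots hμ))
  generalize T.charpoly.roots = R at h'
  induction R using Multiset.induction with
  | empty => simp
  | cons a R ih =>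
    simp only [Multiset.card_cons, Multiset.prod_cons, norm_mul, pow_succ']
    exact mul_le_mul (h' a (by simp)) (ih fun μ hμ => h' μ (by simp [hμ])) (by positivity)
      (norm_nonneg _)

theorem summable_exp_neg_mul_rpow {c α : ℝ} (hc : 0 < c) (hα : 0 < α) :
    Summable fun k : ℕ => Real.exp (-c * ((k : ℝ) + 1) ^ α) := by
  -- `exp y ≥ y ^ m / m!` with `α * m ≥ 2` gives a comparison with `∑ 1 / k ^ 2`
  obtain ⟨m, hm⟩ := exists_nat_gt (2 / α)
  have hm2 : 2 ≤ α * m := by rw [div_lt_iff₀ hα] at hm; linarith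
  have hs : Summable fun k : ℕ => (m.factorial / c ^ m : ℝ) * (1 / ((k : ℝ) + 1) ^ 2) := by
    refine Summable.mul_left _ ?_
    have := (summable_nat_add_iff 1).2 (Real.summable_one_div_nat_pow.2 one_lt_two)
    simpa using this
  refine Summable.of_nonneg_of_le (fun _ => (Real.exp_pos _).le) (fun k => ?_) hs
  have hk : (1 : ℝ) ≤ (k : ℝ) + 1 := by linarith [Nat.cast_nonneg (α := ℝ) k]
  set y : ℝ := c * ((k : ℝ) + 1) ^ α with hy
  have hy0 : 0 < y := by positivity
  have h1 := Real.pow_div_factorial_le_exp y hy0.le m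
  have h2 : c ^ m * ((k : ℝ) + 1) ^ 2 ≤ y ^ m := by
    rw [hy, mul_pow]
    refine mul_le_mul_of_nonneg_left ?_ (by positivity)
    rw [← Real.rpow_natCast (((k : ℝ) + 1) ^ α) m, ← Real.rpow_mul (by positivity),
      ← Real.rpow_natCast]
    exact Real.rpow_le_rpow_of_exponent_le hk (by exact_mod_cast hm2)
  have hf : (0 : ℝ) < m.factorial := by positivity
  rw [neg_mul, Real.exp_neg, inv_eq_one_div, div_mul_div_comm, mul_one,
    div_le_div_iff₀ (Real.exp_pos _) (by positivity), one_mul]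
  rw [div_le_iff₀ hf] at h1
  linarith

/-- For `α ≤ 1` the function `x ^ α` lies above the chord `n ^ α * (x / n)` on `[0, n]`. -/
theorem half_mul_rpow_le_sum_rpow {α : ℝ} (hα : α ≤ 1) (n : ℕ) :
    (n : ℝ) * ((n : ℝ) ^ α / 2) ≤ ∑ k ∈ Finset.range n, ((k : ℝ) + 1) ^ α := by
  rcases Nat.eq_zero_or_pos n with rfl | hn
  · simp
  have hn' : (0 : ℝ) < n := by exact_mod_cast hn
  have h1 : ∀ k ∈ Finset.range n, (n : ℝ) ^ α / n * ((k : ℝ) + 1) ≤ ((k : ℝ) + 1) ^ α := by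
    intro k hk
    have hk1 : ((k : ℝ) + 1) / n ≤ 1 := by
      rw [div_le_one hn']; exact_mod_cast Finset.mem_range.1 hk
    have h2 : ((k : ℝ) + 1) / n ≤ (((k : ℝ) + 1) / n) ^ α := by
      simpa using Real.rpow_le_rpow_of_exponent_ge (by positivity) hk1 hα
    rw [Real.div_rpow (by positivity) hn'.le, div_le_div_iff₀ hn' (by positivity)] at h2
    rw [div_mul_eq_mul_div, div_le_iff₀ hn']
    linarith
  refine le_trans ?_ (Finset.sum_le_sum h1)
  rw [← Finset.mul_sum, Finset.sum_add_distrib]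
  have h3 : (∑ k ∈ Finset.range n, (k : ℝ)) * 2 = n * (n - 1) := by
    have := Finset.sum_range_id_mul_two n
    have h4 : ((∑ k ∈ Finset.range n, k : ℕ) : ℝ) * 2 = n * ((n - 1 : ℕ) : ℝ) := by
      exact_mod_cast this
    rw [Nat.cast_sub hn] at h4
    push_cast at h4
    exact h4
  have h5 : (∑ k ∈ Finset.range n, (k : ℝ)) + ∑ _k ∈ Finset.range n, (1 : ℝ) = n * (n + 1) / 2 := by
    rw [Finset.sum_const, Finset.card_range, nsmul_eq_mul]; linarith
  rw [h5]
  have h6 : (n : ℝ) ^ α / n * (n * (n + 1) / 2) = (n : ℝ) ^ α * (n + 1) / 2 := by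
    field_simp
  rw [h6]
  have : 0 ≤ (n : ℝ) ^ α := by positivity
  linarith

/-! ### Listing a family in decreasing order -/

/-- A family of real weights with finitely many members above each of its values can be listed in
decreasing order: `r i` is the position of `i`, the positions fill an initial segment of `ℕ`, and
`r i` is bounded by the number of weights above `w i`. -/
theorem exists_decreasing_rank {I : Type*} (w : I → ℝ) (hw : ∀ i, {j | w i ≤ w j}.Finite) :
    ∃ r : I → ℕ, Function.Injective r ∧ (∀ i n, n < r i → ∃ j, r j = n) ∧
      (∀ i j, r i ≤ r j → w j ≤ w i) ∧ ∀ i, r i < {j | w i ≤ w j}.ncard := by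
  -- ties are broken by an arbitrary well-order
  let B : I → I → Prop := fun j i => w i < w j ∨ (w i = w j ∧ WellOrderingRel j i)
  have htrans : ∀ {i j k}, B i j → B j k → B i k := by
    rintro i j k (h1 | ⟨h1, h1'⟩) (h2 | ⟨h2, h2'⟩)
    · exact Or.inl (h2.trans h1)
    · exact Or.inl (h2 ▸ h1)
    · exact Or.inl (h1 ▸ h2)
    · exact Or.inr ⟨h2.trans h1, _root_.trans h1' h2'⟩
  have hirr : ∀ i, ¬ B i i := by
    rintro i (h | ⟨-, h⟩)
    · exact lt_irrefl _ h
    · exact irrefl_of WellOrderingRel i h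
  have htri : ∀ i j, i ≠ j → B i j ∨ B j i := by
    intro i j hij
    rcases lt_trichotomy (w i) (w j) with h | h | h
    · exact Or.inr (Or.inl h)
    · rcases trichotomous_of WellOrderingRel i j with h' | h' | h'
      · exact Or.inl (Or.inr ⟨h.symm, h'⟩)
      · exact absurd h' hij
      · exact Or.inr (Or.inr ⟨h, h'⟩)
    · exact Or.inl (Or.inl h)
  have hsub : ∀ i, {j | B j i} ⊆ {j | w i ≤ w j} := by
    rintro i j (h | ⟨h, -⟩)
    · exact h.le
    · exact h.le
  have hfin : ∀ i, {j | B j i}.Finite := fun i => (hw i).subset (hsub i)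
  let r : I → ℕ := fun i => {j | B j i}.ncard
  have hmono : ∀ {i j}, B i j → r i < r j := by
    intro i j h
    refine Set.ncard_lt_ncard ⟨fun k hk => htrans hk h, fun hs => ?_⟩ (hfin j)
    exact hirr i (hs h)
  refine ⟨r, ?_, ?_, ?_, ?_⟩
  · intro i j hij
    by_contra hne
    rcases htri i j hne with h | h
    · exact (hmono h).ne hij
    · exact (hmono h).ne' hij
  · have key : ∀ m i, r i = m → ∀ n < m, ∃ j, r j = n := by
      intro m
      induction m using Nat.strong_induction_on with
      | _ m ih =>
        intro i him n hn
        have hne : {j | B j i}.Nonempty := by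
          rw [← Set.ncard_pos (hfin i)]; change 0 < r i; omega
        obtain ⟨j, hj, hmax⟩ := Set.exists_max_image _ r (hfin i) hne
        have hS : {k | B k i} = insert j {k | B k j} := by
          ext k
          constructor
          · intro hk
            by_cases hkj : k = j
            · exact Or.inl hkj
            · rcases htri k j hkj with h | h
              · exact Or.inr h
              · exact absurd (hmono h) (not_lt.2 (hmax k hk))
          · rintro (rfl | h)
            · exact hj
            · exact htrans h hj
        have hr : r i = r j + 1 := by
          change {k | B k i}.ncard = _
          exact hS ▸ Set.ncard_insert_of_notMem (s := {k | B k j}) (hirr j) (hfin j)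
        rcases Nat.lt_or_ge n (r j) with h | h
        · exact ih (r j) (by omega) j rfl n h
        · exact ⟨j, by omega⟩
    exact fun i => key (r i) i rfl
  · intro i j hij
    by_contra h
    exact absurd (hmono (Or.inl (not_le.1 h) : B j i)) (not_lt.2 hij)
  · intro i
    exact Set.ncard_lt_ncard ⟨hsub i, fun h => hirr i (h (le_refl (w i)))⟩ (hw i)

/-! ### Eigenvalue bounds from invariant subspaces -/

/-- A finite-dimensional invariant subspace of dimension `n > 0` carries an eigenvalue of modulus at
most `M * exp (-c * n ^ α)`. This is all that the eigenvalue asymptotics need. -/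
def HasSmallEigenvalues {E : Type*} [AddCommGroup E] [Module ℂ E] (L : E →ₗ[ℂ] E)
    (M c α : ℝ) : Prop :=
  ∀ V : Submodule ℂ E, FiniteDimensional ℂ V → (∀ v ∈ V, L v ∈ V) → 0 < Module.finrank ℂ V →
    ∀ ε : ℝ, 0 < ε → (∀ (μ : ℂ) (v : E), v ∈ V → v ≠ 0 → L v = μ • v → ε ≤ ‖μ‖) →
      ε ≤ M * Real.exp (-c * (Module.finrank ℂ V : ℝ) ^ α)

/-- An operator with a series expansion with coefficients of size `exp (-a * l ^ α)` has small
eigenvalues on large invariant subspaces. The coefficients enter only through the numbers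
`w k l`, the values of the functionals `φ k` at the vectors of the expansion. -/
theorem hasSmallEigenvalues_of_hasSum {E : Type*} [AddCommGroup E] [Module ℂ E]
    (L : E →ₗ[ℂ] E) (φ : ℕ → E →ₗ[ℂ] ℂ) (w : ℕ → ℕ → ℂ) {C a α : ℝ} (hC : 0 ≤ C) (ha : 0 < a)
    (hα0 : 0 < α) (hα : α ≤ 1)
    (hw : ∀ k l, ‖w k l‖ ≤ C * Real.exp (-a * ((l : ℝ) + 1) ^ α))
    (hsum : ∀ k g, HasSum (fun l => w k l * φ l g) (φ k (L g)))
    (hbdd : ∀ g, ∃ B : ℝ, ∀ k, ‖φ k g‖ ≤ B)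
    (hsep : ∀ g, (∀ k, φ k g = 0) → L g = 0) :
    HasSmallEigenvalues L (C * ∑' l : ℕ, Real.exp (-(a / 2) * ((l : ℝ) + 1) ^ α)) (a / 4) α := by
  intro V _ hV hn ε hε hev
  set n := Module.finrank ℂ V with hn_def
  set u : ℕ → ℝ := fun l => Real.exp (-(a / 2) * ((l : ℝ) + 1) ^ α) with hu
  have hu0 : ∀ l, 0 ≤ u l := fun l => (Real.exp_pos _).le
  have hanti : Antitone u := by
    intro k l hkl
    refine Real.exp_le_exp.2 ?_
    have : ((k : ℝ) + 1) ^ α ≤ ((l : ℝ) + 1) ^ α :=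
      Real.rpow_le_rpow (by positivity) (by simpa using hkl) hα0.le
    nlinarith
  let T : V →ₗ[ℂ] V := L.restrict hV
  have hevT : ∀ μ : ℂ, Module.End.HasEigenvalue T μ → ε ≤ ‖μ‖ := by
    intro μ hμ
    obtain ⟨v, hv⟩ := hμ.exists_hasEigenvector
    refine hev μ v v.2 (fun h => hv.2 (Subtype.ext h)) ?_
    exact congrArg Subtype.val hv.apply_eq_smul
  have hlow := pow_finrank_le_norm_det T hε.le hevT
  have hdet0 : LinearMap.det T ≠ 0 := by
    intro h
    rw [h, norm_zero] at hlow
    exact absurd hlow (not_le.2 (pow_pos hε _))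
  have hinj : ∀ v : V, T v = 0 → v = 0 := by
    intro v hv
    have : LinearMap.ker T = ⊥ := by
      by_contra hk
      exact hdet0 (LinearMap.det_eq_zero_iff_ker_ne_bot.2 hk)
    exact (LinearMap.ker_eq_bot'.1 this) v hv
  have hup := norm_det_le_of_hasSum T (fun k => (φ k).comp V.subtype) w u C hC hu0 hanti
    (summable_exp_neg_mul_rpow (half_pos ha) hα0)
    (fun k l => (hw k l).trans_eq (by
      rw [hu]; simp only; rw [← Real.exp_nat_mul]; congr 2; push_cast; ring))
    (fun k g => hsum k g) (fun g => hbdd g)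
    (fun g hg => hinj g (Subtype.ext (hsep g hg)))
  have hprod : ∏ k ∈ Finset.range n, u k ≤ Real.exp (-(a / 4) * (n : ℝ) ^ α) ^ n := by
    rw [hu, ← Real.exp_sum, ← Real.exp_nat_mul, ← Finset.mul_sum]
    refine Real.exp_le_exp.2 ?_
    have := half_mul_rpow_le_sum_rpow hα n
    nlinarith
  have hS : 0 ≤ C * ∑' l, u l := mul_nonneg hC (tsum_nonneg hu0)
  refine le_of_pow_le_pow_left₀ hn.ne' (mul_nonneg hS (Real.exp_pos _).le) ?_
  rw [mul_pow]
  exact hlow.trans (hup.trans (mul_le_mul_of_nonneg_left hprod (pow_nonneg hS _)))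

section Eigenvalues

variable {E : Type*} [AddCommGroup E] [Module ℂ E] {L : E →ₗ[ℂ] E} {M c α : ℝ}

/-- Since `M * exp (-c * n ^ α)` tends to `0`, invariant subspaces on which all eigenvalues have
modulus at least `ε` have bounded dimension. -/
theorem HasSmallEigenvalues.exists_finrank_le (h : HasSmallEigenvalues L M c α) (hc : 0 < c)
    (hα : 0 < α) {ε : ℝ} (hε : 0 < ε) : ∃ N : ℕ, ∀ V : Submodule ℂ E, FiniteDimensional ℂ V →
      (∀ v ∈ V, L v ∈ V) → (∀ (μ : ℂ) (v : E), v ∈ V → v ≠ 0 → L v = μ • v → ε ≤ ‖μ‖) →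
      Module.finrank ℂ V ≤ N := by
  have hlim : Filter.Tendsto (fun n : ℕ => M * Real.exp (-c * (n : ℝ) ^ α)) Filter.atTop
      (𝓝 (M * 0)) := by
    refine Filter.Tendsto.const_mul _ (Real.tendsto_exp_atBot.comp ?_)
    exact ((tendsto_rpow_atTop hα).comp tendsto_natCast_atTop_atTop).const_mul_atTop_of_neg
      (neg_neg_of_pos hc)
  rw [mul_zero] at hlim
  obtain ⟨N, hN⟩ := Filter.eventually_atTop.1 (hlim.eventually (gt_mem_nhds hε))
  refine ⟨N, fun V hfin hV hev => ?_⟩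
  by_contra hlt
  rw [not_le] at hlt
  exact absurd (h V hfin hV (by omega) ε hε hev) (not_le.2 (hN _ hlt.le))

theorem eq_zero_of_mem_maxGenEigenspace_of_apply_eq {μ ν : ℂ} (hne : ν ≠ μ) {v : E}
    (hv : v ∈ Module.End.maxGenEigenspace L μ) (hLv : L v = ν • v) : v = 0 := by
  have h1 : v ∈ Module.End.maxGenEigenspace L ν := by
    refine (Module.End.mem_maxGenEigenspace L ν v).2 ⟨1, ?_⟩
    simp [hLv]
  exact (Submodule.disjoint_def.1
    ((Module.End.independent_maxGenEigenspace L).pairwiseDisjoint hne)) v h1 hv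

/-- Each finite-dimensional subspace of a generalized eigenspace lies in a finite-dimensional
invariant one. -/
theorem exists_invariant_of_le_maxGenEigenspace {μ : ℂ} {V : Submodule ℂ E}
    [FiniteDimensional ℂ V] (hV : V ≤ Module.End.maxGenEigenspace L μ) :
    ∃ W : Submodule ℂ E, FiniteDimensional ℂ W ∧ V ≤ W ∧
      W ≤ Module.End.maxGenEigenspace L μ ∧ ∀ v ∈ W, L v ∈ W := by
  -- with `N = L - μ` nilpotent on `V`, the sum of the spaces `N ^ i V` is invariant
  set N : Module.End ℂ E := L - μ • 1 with hN
  obtain ⟨k, hk⟩ : ∃ k, ∀ v ∈ V, (N ^ k) v = 0 := by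
    obtain ⟨s, hs⟩ := (Module.Finite.iff_fg.1 ‹FiniteDimensional ℂ V›)
    have hs' : ∀ v ∈ s, ∃ k, (N ^ k) v = 0 := fun v hv =>
      (Module.End.mem_maxGenEigenspace L μ v).1 (hV (hs ▸ Submodule.subset_span hv))
    choose! m hm using hs'
    refine ⟨s.sup m, ?_⟩
    have hle : V ≤ LinearMap.ker (N ^ s.sup m) := by
      rw [← hs, Submodule.span_le]
      intro v hv
      obtain ⟨j, hj⟩ := Nat.exists_eq_add_of_le' (Finset.le_sup (f := m) hv)
      change (N ^ s.sup m) v = 0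
      rw [hj, pow_add, Module.End.mul_apply, hm v hv, map_zero]
    exact fun v hv => hle hv
  have hNmem : ∀ (i : ℕ) (v : E), v ∈ Module.End.maxGenEigenspace L μ →
      (N ^ i) v ∈ Module.End.maxGenEigenspace L μ := by
    intro i v hv
    refine Module.End.mapsTo_maxGenEigenspace_of_comm ?_ μ hv
    exact (((Commute.refl L).sub_right ((Commute.one_right L).smul_right μ))).pow_right i
  refine ⟨⨆ i : Fin (k + 1), V.map (N ^ (i : ℕ)), inferInstance, ?_, ?_, ?_⟩
  · refine le_trans ?_ (le_iSup _ (0 : Fin (k + 1)))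
    exact fun v hv => ⟨v, hv, by simp⟩
  · refine iSup_le fun i => ?_
    rintro _ ⟨v, hv, rfl⟩
    exact hNmem i v (hV hv)
  · set W := ⨆ i : Fin (k + 1), V.map (N ^ (i : ℕ)) with hW
    have hWN : W ≤ W.comap N := by
      refine iSup_le fun i => ?_
      rintro _ ⟨v, hv, rfl⟩
      change N ((N ^ (i : ℕ)) v) ∈ W
      rw [← Module.End.mul_apply, ← pow_succ']
      by_cases hi : (i : ℕ) + 1 < k + 1
      · exact le_iSup (fun i : Fin (k + 1) => V.map (N ^ (i : ℕ))) ⟨i + 1, hi⟩ ⟨v, hv, rfl⟩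
      · have : (i : ℕ) = k := by omega
        rw [this, pow_succ', Module.End.mul_apply, hk v hv, map_zero]
        exact W.zero_mem
    intro v hv
    have h1 : L v = N v + μ • v := by simp [hN]
    rw [h1]
    exact W.add_mem (hWN hv) (W.smul_mem _ hv)

theorem HasSmallEigenvalues.finiteDimensional_maxGenEigenspace (h : HasSmallEigenvalues L M c α)
    (hc : 0 < c) (hα : 0 < α) {μ : ℂ} (hμ : μ ≠ 0) :
    FiniteDimensional ℂ (Module.End.maxGenEigenspace L μ) := by
  obtain ⟨N, hN⟩ := h.exists_finrank_le hc hα (norm_pos_iff.2 hμ)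
  set G := Module.End.maxGenEigenspace L μ with hG
  refine Module.rank_lt_aleph0_iff.1 (lt_of_le_of_lt ?_ (Cardinal.natCast_lt_aleph0 (n := N)))
  refine rank_le fun s hs => ?_
  let V : Submodule ℂ E := (Submodule.span ℂ (s : Set G)).map G.subtype
  obtain ⟨W, hWfin, hVW, hWG, hWL⟩ := exists_invariant_of_le_maxGenEigenspace (L := L) (μ := μ)
    (V := V) (by rintro _ ⟨v, -, rfl⟩; exact v.2)
  have hcard : s.card = Module.finrank ℂ V := by
    rw [(Submodule.equivMapOfInjective G.subtype G.injective_subtype _).symm.finrank_eq]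
    exact (finrank_span_finset_eq_card hs).symm
  rw [hcard]
  refine (Submodule.finrank_mono hVW).trans (hN W hWfin hWL fun ν v hv hv0 hLv => ?_)
  by_contra hlt
  refine hv0 (eq_zero_of_mem_maxGenEigenspace_of_apply_eq ?_ (hWG hv) hLv)
  rintro rfl
  exact hlt le_rfl

theorem finrank_finset_sup_of_iSupIndep {ι : Type*} {W : ι → Submodule ℂ E} (hW : iSupIndep W)
    (F : Finset ι) (hfin : ∀ i ∈ F, FiniteDimensional ℂ (W i)) :
    FiniteDimensional ℂ (F.sup W : Submodule ℂ E) ∧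
      Module.finrank ℂ (F.sup W : Submodule ℂ E) = ∑ i ∈ F, Module.finrank ℂ (W i) := by
  classical
  induction F using Finset.induction_on with
  | empty => rw [Finset.sup_empty]; exact ⟨inferInstance, by simp⟩
  | insert a F ha ih =>
    obtain ⟨h1, h2⟩ := ih fun i hi => hfin i (Finset.mem_insert_of_mem hi)
    have h3 := hfin a (Finset.mem_insert_self a F)
    rw [Finset.sup_insert, Finset.sum_insert ha]
    refine ⟨Submodule.finiteDimensional_sup _ _, ?_⟩
    have hdis : Disjoint (W a) (F.sup W) :=
      (hW.supIndep' (insert a F)) (Finset.subset_insert a F) (Finset.mem_insert_self a F) ha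
    have := Submodule.finrank_sup_add_finrank_inf_eq (W a) (F.sup W)
    rw [hdis.eq_bot, finrank_bot, add_zero] at this
    rw [this, h2]

/-- A finite sum of generalized eigenspaces is invariant and carries no further eigenvalues, so that
it is a test space for `HasSmallEigenvalues`. -/
theorem finset_sup_maxGenEigenspace (F : Finset ℂ) :
    (∀ v ∈ F.sup (Module.End.maxGenEigenspace L), L v ∈ F.sup (Module.End.maxGenEigenspace L)) ∧
    ∀ (μ : ℂ) (v : E), v ∈ F.sup (Module.End.maxGenEigenspace L) → v ≠ 0 → L v = μ • v →
      μ ∈ F := by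
  classical
  constructor
  · have : F.sup (Module.End.maxGenEigenspace L) ≤
        (F.sup (Module.End.maxGenEigenspace L)).comap L := by
      refine Finset.sup_le fun μ hμ v hv => ?_
      exact Finset.le_sup (f := Module.End.maxGenEigenspace L) hμ
        (Module.End.mapsTo_maxGenEigenspace_of_comm (Commute.refl L) μ hv)
    exact fun v hv => this hv
  · intro μ v hv hv0 hLv
    by_contra hμ
    have h1 : v ∈ Module.End.maxGenEigenspace L μ :=
      (Module.End.mem_maxGenEigenspace L μ v).2 ⟨1, by simp [hLv]⟩
    have hdis := ((Module.End.independent_maxGenEigenspace L).supIndep' (insert μ F))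
      (Finset.subset_insert μ F) (Finset.mem_insert_self μ F) hμ
    exact hv0 (Submodule.disjoint_def.1 hdis v h1 hv)

theorem HasSmallEigenvalues.exists_isEigenvalueSequence (h : HasSmallEigenvalues L M c α)
    (hc : 0 < c) (hα : 0 < α) : ∃ ev : ℕ → ℂ, IsEigenvalueSequence L ev := by
  classical
  have hfd : ∀ μ : ℂ, μ ≠ 0 → FiniteDimensional ℂ (Module.End.maxGenEigenspace L μ) :=
    fun μ hμ => h.finiteDimensional_maxGenEigenspace hc hα hμ
  let m : ℂ → ℕ := fun μ => Module.finrank ℂ (Module.End.maxGenEigenspace L μ)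
  -- an index for every eigenvalue and every unit of its multiplicity
  let I := Σ μ : {μ : ℂ // μ ≠ 0}, Fin (m μ)
  let w : I → ℝ := fun i => ‖(i.1 : ℂ)‖
  have hw0 : ∀ i, 0 < w i := fun i => norm_pos_iff.2 i.1.2
  have hfin : ∀ ε : ℝ, 0 < ε → {μ : {μ : ℂ // μ ≠ 0} | ε ≤ ‖(μ : ℂ)‖ ∧ 0 < m μ}.Finite := by
    intro ε hε
    obtain ⟨N, hN⟩ := h.exists_finrank_le hc hα hε
    by_contra hinf
    obtain ⟨F, hF, hcard⟩ := Set.Infinite.exists_subset_card_eq hinf (N + 1)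
    let F' : Finset ℂ := F.map (Function.Embedding.subtype _)
    have hF' : ∀ μ ∈ F', μ ≠ 0 ∧ ε ≤ ‖μ‖ ∧ 0 < m μ := by
      intro μ hμ
      obtain ⟨ν, hν, rfl⟩ := Finset.mem_map.1 hμ
      exact ⟨ν.2, hF hν⟩
    obtain ⟨h1, h2⟩ := finrank_finset_sup_of_iSupIndep
      (Module.End.independent_maxGenEigenspace L) F' fun μ hμ => hfd μ (hF' μ hμ).1
    obtain ⟨h3, h4⟩ := finset_sup_maxGenEigenspace (L := L) F'
    have h5 := hN _ h1 h3 fun μ v hv hv0 hLv => (hF' μ (h4 μ v hv hv0 hLv)).2.1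
    rw [h2] at h5
    have h6 : F'.card • 1 ≤ ∑ μ ∈ F', Module.finrank ℂ (Module.End.maxGenEigenspace L μ) :=
      Finset.card_nsmul_le_sum _ _ _ fun μ hμ => (hF' μ hμ).2.2
    rw [Finset.card_map, hcard] at h6
    simp at h6
    omega
  have hwfin : ∀ i, {j | w i ≤ w j}.Finite := by
    intro i
    refine ((hfin (w i) (hw0 i)).biUnion fun μ _ => Set.finite_range (Sigma.mk μ)).subset ?_
    rintro ⟨μ, k⟩ hj
    exact Set.mem_biUnion (show μ ∈ _ from ⟨hj, k.pos⟩) ⟨k, rfl⟩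
  obtain ⟨r, hrinj, hrlow, hranti, -⟩ := exists_decreasing_rank w hwfin
  let ev : ℕ → ℂ := fun n => if hn : ∃ i, r i = n then (hn.choose.1 : ℂ) else 0
  have hev : ∀ i, ev (r i) = i.1 := by
    intro i
    have hi : ∃ j, r j = r i := ⟨i, rfl⟩
    simp only [ev, dif_pos hi, hrinj hi.choose_spec]
  have hev0 : ∀ n, ev n ≠ 0 → ∃ i, r i = n := by
    intro n hn
    by_contra hne
    exact hn (dif_neg hne)
  refine ⟨ev, ?_, hfd, ?_⟩
  · intro n n' hnn
    by_cases h0 : ev n' = 0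
    · simp [h0]
    · obtain ⟨i', rfl⟩ := hev0 n' h0
      obtain ⟨i, rfl⟩ : ∃ i, r i = n := by
        rcases hnn.lt_or_eq with hlt | rfl
        · exact hrlow i' n hlt
        · exact ⟨i', rfl⟩
      simp only [hev]
      exact hranti i i' hnn
  · intro μ hμ
    have hset : {n | ev n = μ} = Set.range (fun k : Fin (m μ) => r ⟨⟨μ, hμ⟩, k⟩) := by
      ext n
      constructor
      · intro hn
        obtain ⟨i, rfl⟩ := hev0 n (by rw [show ev n = μ from hn]; exact hμ)
        obtain ⟨⟨ν, hν⟩, k⟩ := i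
        have : ν = μ := by simpa [hev] using hn
        subst this
        exact ⟨k, rfl⟩
      · rintro ⟨k, rfl⟩
        exact hev _
    have hinj : Function.Injective (fun k : Fin (m μ) => r ⟨⟨μ, hμ⟩, k⟩) := fun k k' hkk =>
      eq_of_heq (Sigma.mk.inj (hrinj hkk)).2
    rw [hset, ← Set.image_univ, hinj.encard_image, Set.encard_univ]
    simp [m]

theorem HasSmallEigenvalues.mem_expClass (h : HasSmallEigenvalues L M c α) (hM : 0 ≤ M)
    (hc : 0 < c) (hα : 0 < α) {ev : ℕ → ℂ} (hev : IsEigenvalueSequence L ev) :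
    ev ∈ ExpClass α := by
  classical
  refine Set.mem_biUnion (show c ∈ Set.Ioi (0 : ℝ) from hc) ⟨M, ?_⟩
  rintro _ ⟨n, rfl⟩
  rcases eq_or_ne (ev n) 0 with h0 | h0
  · simpa [h0] using hM
  -- the test space belongs to the values of `ev` up to index `n`; its dimension is at least `n + 1`
  let F : Finset ℂ := (Finset.range (n + 1)).image ev
  have hF : ∀ μ ∈ F, ‖ev n‖ ≤ ‖μ‖ := by
    intro μ hμ
    obtain ⟨k, hk, rfl⟩ := Finset.mem_image.1 hμ
    exact hev.antitone_norm (Nat.lt_succ_iff.1 (Finset.mem_range.1 hk))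
  have hF0 : ∀ μ ∈ F, μ ≠ 0 := fun μ hμ =>
    norm_pos_iff.1 ((norm_pos_iff.2 h0).trans_le (hF μ hμ))
  obtain ⟨h1, h2⟩ := finrank_finset_sup_of_iSupIndep
    (Module.End.independent_maxGenEigenspace L) F fun μ hμ => hev.finiteDimensional μ (hF0 μ hμ)
  obtain ⟨h3, h4⟩ := finset_sup_maxGenEigenspace (L := L) F
  have hdim : n + 1 ≤ Module.finrank ℂ (F.sup (Module.End.maxGenEigenspace L) : Submodule ℂ E) := by
    rw [h2]
    calc n + 1 = (Finset.range (n + 1)).card := (Finset.card_range _).symm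
      _ = ∑ μ ∈ F, ((Finset.range (n + 1)).filter fun k => ev k = μ).card :=
        Finset.card_eq_sum_card_image ev _
      _ ≤ _ := Finset.sum_le_sum fun μ hμ => by
        have h5 := hev.encard_eq μ (hF0 μ hμ)
        have h6 : (((Finset.range (n + 1)).filter fun k => ev k = μ : Finset ℕ) : Set ℕ).encard ≤
            {k | ev k = μ}.encard := Set.encard_le_encard fun k hk => by
          simpa using (Finset.mem_filter.1 hk).2
        rw [h5, Set.encard_coe_eq_coe_finsetCard] at h6
        exact_mod_cast h6
  have h7 := h _ h1 h3 (by omega) ‖ev n‖ (norm_pos_iff.2 h0) fun μ v hv hv0 hLv =>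
    hF μ (h4 μ v hv hv0 hLv)
  have h8 : ((n : ℝ) + 1) ^ α ≤
      (Module.finrank ℂ (F.sup (Module.End.maxGenEigenspace L) : Submodule ℂ E) : ℝ) ^ α :=
    Real.rpow_le_rpow (by positivity) (by exact_mod_cast hdim) hα.le
  have h9 : ‖ev n‖ ≤ M * Real.exp (-(c * ((n : ℝ) + 1) ^ α)) := by
    refine h7.trans (mul_le_mul_of_nonneg_left (Real.exp_le_exp.2 ?_) hM)
    nlinarith
  simp only
  rw [Real.exp_neg, ← div_eq_mul_inv, le_div_iff₀ (Real.exp_pos _)] at h9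
  exact h9

end Eigenvalues

/-! ### Taylor expansion on polydiscs -/

/-- The product of `d` absolutely convergent series is a series over `Fin d → ℕ`. -/
theorem hasSum_pi_prod {d : ℕ} {g : Fin d → ℕ → ℂ} {a : Fin d → ℂ}
    (hg : ∀ i, HasSum (g i) (a i)) (hn : ∀ i, Summable fun k => ‖g i k‖) :
    HasSum (fun β : Fin d → ℕ => ∏ i, g i (β i)) (∏ i, a i) ∧
      Summable fun β : Fin d → ℕ => ‖∏ i, g i (β i)‖ := by
  induction d with
  | zero => exact ⟨by simp, (hasSum_unique _).summable⟩
  | succ d ih =>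
    obtain ⟨h1, h2⟩ := ih (fun i => hg i.succ) fun i => hn i.succ
    have h3 : Summable fun x : ℕ × (Fin d → ℕ) => ‖g 0 x.1 * ∏ i, g (Fin.succ i) (x.2 i)‖ :=
      
      Summable.mul_norm (f := g 0) (g := fun β : Fin d → ℕ => ∏ i, g (Fin.succ i) (β i)) (hn 0) h2
    have h4 := (hg 0).mul h1 h3.of_norm
    refine ⟨?_, ?_⟩
    · rw [← (Fin.consEquiv fun _ => ℕ).hasSum_iff, Fin.prod_univ_succ]
      refine Eq.subst (motive := fun f => HasSum f _) (funext fun x => ?_) h4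
      simp [Fin.prod_univ_succ]
    · rw [← (Fin.consEquiv fun _ => ℕ).summable_iff]
      refine (summable_congr fun x => ?_).1 h3
      simp [Fin.prod_univ_succ]

section Polydisc

open MeasureTheory Metric Real

variable {d : ℕ}

theorem torusMap_mem_closedBall (c : Fin d → ℂ) {r : ℝ} (hr : 0 ≤ r) (θ : Fin d → ℝ) :
    torusMap c (fun _ => r) θ ∈ closedBall c r := by
  rw [mem_closedBall, dist_pi_le_iff hr]
  intro i
  simp [torusMap, dist_eq_norm, abs_of_nonneg hr]

theorem norm_torusMap_sub (c : Fin d → ℂ) {r : ℝ} (hr : 0 ≤ r) (θ : Fin d → ℝ) (i : Fin d) :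
    ‖torusMap c (fun _ => r) θ i - c i‖ = r := by
  simp [torusMap, abs_of_nonneg hr]

theorem continuous_torusMap (c : Fin d → ℂ) (R : Fin d → ℝ) : Continuous (torusMap c R) := by
  unfold torusMap
  fun_prop

theorem continuous_torusMap_sub (c : Fin d → ℂ) (R : Fin d → ℝ) (i : Fin d) (a : ℂ) :
    Continuous fun θ => torusMap c R θ i - a := by
  unfold torusMap
  fun_prop

theorem continuous_comp_torusMap {F : (Fin d → ℂ) → ℂ} {c : Fin d → ℂ} {r : ℝ} (hr : 0 ≤ r)
    (hF : ContinuousOn F (closedBall c r)) :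
    Continuous fun θ => F (torusMap c (fun _ => r) θ) :=
  hF.comp_continuous (continuous_torusMap _ _) (torusMap_mem_closedBall c hr)

theorem torusIntegrable_of_continuous {f : (Fin d → ℂ) → ℂ} {c : Fin d → ℂ} {R : Fin d → ℝ}
    (hf : Continuous fun θ => f (torusMap c R θ)) : TorusIntegrable f c R :=
  hf.integrableOn_Icc

theorem torusMap_sub_ne_zero {c w : Fin d → ℂ} {r : ℝ} (hw : w ∈ ball c r)
    (θ : Fin d → ℝ) (i : Fin d) : torusMap c (fun _ => r) θ i - w i ≠ 0 := by
  have hr : 0 < r := pos_of_mem_ball hw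
  intro h
  have h1 : ‖torusMap c (fun _ => r) θ i - c i‖ < r := by
    rw [sub_eq_zero.1 h, ← dist_eq_norm]
    exact (dist_le_pi_dist w c i).trans_lt hw
  rw [norm_torusMap_sub c hr.le] at h1
  exact lt_irrefl _ h1

/-- The Cauchy integral formula on a polydisc. The radius is the same in all variables, so that the
polydisc is a ball of the sup norm. -/
theorem torusIntegral_prod_inv_mul {F : (Fin d → ℂ) → ℂ} {c w : Fin d → ℂ} {r : ℝ}
    (hF : ∀ z ∈ closedBall c r, DifferentiableAt ℂ F z) (hw : w ∈ ball c r) :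
    (∯ ζ in T(c, fun _ => r), (∏ i, (ζ i - w i)⁻¹) * F ζ) = (2 * π * Complex.I) ^ d * F w := by
  have hr : 0 < r := pos_of_mem_ball hw
  induction d with
  | zero => simp [Subsingleton.elim c w]
  | succ d ih =>
    have hcont : Continuous fun θ =>
        (∏ i, (torusMap c (fun _ => r) θ i - w i)⁻¹) * F (torusMap c (fun _ => r) θ) := by
      refine Continuous.mul (continuous_finsetProd _ fun i _ => ?_) (continuous_comp_torusMap hr.le
        fun z hz => (hF z hz).continuousAt.continuousWithinAt)
      exact (continuous_torusMap_sub c _ i (w i)).inv₀ fun θ => torusMap_sub_ne_zero hw θ i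
    rw [torusIntegral_succ (torusIntegrable_of_continuous
      (f := fun ζ => (∏ i, (ζ i - w i)⁻¹) * F ζ) hcont)]
    have hw0 : w 0 ∈ ball (c 0) r := (dist_le_pi_dist w c 0).trans_lt hw
    have hw' : w ∘ Fin.succ ∈ ball (c ∘ Fin.succ) r := by
      rw [mem_ball, dist_pi_lt_iff hr]
      exact fun i => (dist_le_pi_dist w c i.succ).trans_lt hw
    have hmem : ∀ (x : ℂ) (y : Fin d → ℂ), x ∈ closedBall (c 0) r →
        y ∈ closedBall (c ∘ Fin.succ) r → (Fin.cons x y : Fin (d + 1) → ℂ) ∈ closedBall c r := by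
      intro x y hx hy
      rw [mem_closedBall, dist_pi_le_iff hr.le]
      refine Fin.cases ?_ fun i => ?_
      · simpa using hx
      · simpa using (dist_le_pi_dist y (c ∘ Fin.succ) i).trans hy
    have hinner : ∀ x ∈ sphere (c 0) r,
        (∯ y in T(c ∘ Fin.succ, (fun _ => r) ∘ Fin.succ),
          (∏ i, ((Fin.cons x y : Fin (d + 1) → ℂ) i - w i)⁻¹) * F (Fin.cons x y)) =
        (2 * π * Complex.I) ^ d * ((x - w 0)⁻¹ • F (Fin.cons x (w ∘ Fin.succ))) := by
      intro x hx
      have h1 := ih (F := fun y => F (Fin.cons x y)) (c := c ∘ Fin.succ) (w := w ∘ Fin.succ)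
        (fun y hy => by
          have hd : DifferentiableAt ℂ (fun y : Fin d → ℂ => (Fin.cons x y : Fin (d + 1) → ℂ)) y :=
            differentiableAt_pi.2 (Fin.cases (by simp) fun i => by
              simpa using differentiableAt_apply i y)
          exact (hF _ (hmem x y (sphere_subset_closedBall hx) hy)).comp y hd) hw'
      have h2 := torusIntegral_const_mul (x - w 0)⁻¹
        (fun y : Fin d → ℂ => (∏ i, (y i - (w ∘ Fin.succ) i)⁻¹) * F (Fin.cons x y))
        (c ∘ Fin.succ) (fun _ => r)
      rw [h1] at h2
      rw [smul_eq_mul, mul_left_comm, ← h2]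
      congr 1
      ext y
      simp only [Fin.prod_univ_succ, Fin.cons_zero, Fin.cons_succ, Function.comp_apply, mul_assoc]
    rw [circleIntegral.integral_congr hr.le hinner, circleIntegral.integral_const_mul]
    have h1d := Complex.circleIntegral_sub_inv_smul_of_differentiable_on_off_countable
      (f := fun x => F (Fin.cons x (w ∘ Fin.succ))) (s := ∅) Set.countable_empty hw0
    have hdx : ∀ x ∈ closedBall (c 0) r,
        DifferentiableAt ℂ (fun x => F (Fin.cons x (w ∘ Fin.succ))) x := by
      intro x hx
      have hd : DifferentiableAt ℂ
          (fun x : ℂ => (Fin.cons x (w ∘ Fin.succ) : Fin (d + 1) → ℂ)) x :=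
        differentiableAt_pi.2 (Fin.cases (by simp) fun i => by simp)
      exact (hF _ (hmem x _ hx (ball_subset_closedBall hw'))).comp x hd
    rw [h1d (fun x hx => (hdx x hx).continuousAt.continuousWithinAt)
      (fun x hx => hdx x (ball_subset_closedBall hx.1)), smul_eq_mul]
    have hcons : (Fin.cons (w 0) (w ∘ Fin.succ) : Fin (d + 1) → ℂ) = w := Fin.cons_self_tail w
    rw [hcons]
    ring

/-- Termwise integration over a torus of a uniformly dominated series. -/
theorem hasSum_torusIntegral {ι : Type*} [Countable ι] {f : ι → (Fin d → ℂ) → ℂ}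
    {g : (Fin d → ℂ) → ℂ} {c : Fin d → ℂ} {R : Fin d → ℝ} {b : ι → ℝ}
    (hf : ∀ i, Continuous fun θ => f i (torusMap c R θ))
    (hb : ∀ i θ, ‖f i (torusMap c R θ)‖ ≤ b i) (hbs : Summable b)
    (hsum : ∀ θ, HasSum (fun i => f i (torusMap c R θ)) (g (torusMap c R θ))) :
    HasSum (fun i => ∯ ζ in T(c, R), f i ζ) (∯ ζ in T(c, R), g ζ) := by
  unfold torusIntegral
  refine hasSum_integral_of_dominated_convergence (fun i _ => (∏ j, |R j|) * b i) (fun i => ?_)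
    (fun i => ?_) (Filter.Eventually.of_forall fun θ => hbs.mul_left _) ?_
    (Filter.Eventually.of_forall fun θ => (hsum θ).const_smul _)
  · exact (Continuous.smul (f := fun θ : Fin d → ℝ =>
      ∏ j, (R j * Complex.exp (θ j * Complex.I) * Complex.I : ℂ)) (by fun_prop)
      (hf i)).aestronglyMeasurable
  · refine Filter.Eventually.of_forall fun θ => ?_
    rw [norm_smul]
    have : ‖∏ j, (R j * Complex.exp (θ j * Complex.I) * Complex.I : ℂ)‖ = ∏ j, |R j| := by simp
    rw [this]
    exact mul_le_mul_of_nonneg_left (hb i θ) (Finset.prod_nonneg fun _ _ => abs_nonneg _)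
  · exact integrableOn_const (by exact isCompact_Icc.measure_lt_top.ne)

/-- The Taylor coefficient with multi-index `β` of `F` at `c`, scaled by `r ^ |β|`, as a Cauchy
integral over the torus of radius `r`. -/
noncomputable def scaledTaylorCoeff (c : Fin d → ℂ) (r : ℝ) (β : Fin d → ℕ)
    (F : (Fin d → ℂ) → ℂ) : ℂ :=
  ((2 * π * Complex.I) ^ d)⁻¹ *
    ∯ ζ in T(c, fun _ => r), (∏ i, ((r : ℂ) ^ β i * ((ζ i - c i) ^ (β i + 1))⁻¹)) * F ζ

/-- The kernel of `scaledTaylorCoeff` has constant modulus on the torus, so that the scaled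
coefficients are bounded by the sup norm. -/
theorem norm_taylorKernel (c : Fin d → ℂ) {r : ℝ} (hr : 0 < r) (β : Fin d → ℕ) (θ : Fin d → ℝ) :
    ‖∏ i, ((r : ℂ) ^ β i * ((torusMap c (fun _ => r) θ i - c i) ^ (β i + 1))⁻¹)‖ = (r ^ d)⁻¹ := by
  rw [norm_prod]
  have : ∀ i, ‖(r : ℂ) ^ β i * ((torusMap c (fun _ => r) θ i - c i) ^ (β i + 1))⁻¹‖ = r⁻¹ := by
    intro i
    rw [norm_mul, norm_inv, norm_pow, norm_pow, norm_torusMap_sub c hr.le, Complex.norm_real,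
      Real.norm_of_nonneg hr.le, pow_succ]
    field_simp
  rw [Finset.prod_congr rfl fun i _ => this i]
  simp

theorem continuous_taylorKernel (c : Fin d → ℂ) {r : ℝ} (hr : 0 < r) (β : Fin d → ℕ) :
    Continuous fun θ =>
      ∏ i, ((r : ℂ) ^ β i * ((torusMap c (fun _ => r) θ i - c i) ^ (β i + 1))⁻¹) := by
  refine continuous_finsetProd _ fun i _ => continuous_const.mul (Continuous.inv₀ ?_ fun θ => ?_)
  · exact (continuous_torusMap_sub c _ i (c i)).pow _
  · exact pow_ne_zero _ (torusMap_sub_ne_zero (mem_ball_self hr) θ i)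

theorem norm_scaledTaylorCoeff_le {c : Fin d → ℂ} {r : ℝ} (hr : 0 < r) (β : Fin d → ℕ)
    {F : (Fin d → ℂ) → ℂ} {B : ℝ} (hB : ∀ z ∈ closedBall c r, ‖F z‖ ≤ B) :
    ‖scaledTaylorCoeff c r β F‖ ≤ B := by
  have h1 := norm_torusIntegral_le_of_norm_le_const (c := c) (R := fun _ => r) (C := (r ^ d)⁻¹ * B)
    (f := fun ζ => (∏ i, ((r : ℂ) ^ β i * ((ζ i - c i) ^ (β i + 1))⁻¹)) * F ζ) (fun θ => by
      rw [norm_mul, norm_taylorKernel c hr]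
      exact mul_le_mul_of_nonneg_left (hB _ (torusMap_mem_closedBall c hr.le θ)) (by positivity))
  rw [scaledTaylorCoeff, norm_mul, norm_inv, norm_pow]
  have h2 : ‖(2 * π * Complex.I : ℂ)‖ = 2 * π := by simp [abs_of_pos Real.pi_pos]
  rw [h2, inv_mul_le_iff₀ (by positivity)]
  refine h1.trans_eq ?_
  simp only [abs_of_pos hr, Finset.prod_const, Finset.card_univ, Fintype.card_fin]
  field_simp

theorem scaledTaylorCoeff_add {c : Fin d → ℂ} {r : ℝ} (hr : 0 < r) (β : Fin d → ℕ)
    {F G : (Fin d → ℂ) → ℂ} (hF : ContinuousOn F (closedBall c r))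
    (hG : ContinuousOn G (closedBall c r)) :
    scaledTaylorCoeff c r β (F + G) = scaledTaylorCoeff c r β F + scaledTaylorCoeff c r β G := by
  unfold scaledTaylorCoeff
  rw [← mul_add, ← torusIntegral_add]
  · simp [mul_add]
  · exact torusIntegrable_of_continuous
      ((continuous_taylorKernel c hr β).mul (continuous_comp_torusMap hr.le hF))
  · exact torusIntegrable_of_continuous
      ((continuous_taylorKernel c hr β).mul (continuous_comp_torusMap hr.le hG))

theorem scaledTaylorCoeff_smul (c : Fin d → ℂ) (r : ℝ) (β : Fin d → ℕ) (a : ℂ)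
    (F : (Fin d → ℂ) → ℂ) :
    scaledTaylorCoeff c r β (a • F) = a * scaledTaylorCoeff c r β F := by
  unfold scaledTaylorCoeff
  rw [mul_left_comm, ← torusIntegral_const_mul a]
  simp [mul_left_comm]

/-- The Taylor expansion on a polydisc. -/
theorem hasSum_scaledTaylorCoeff {F : (Fin d → ℂ) → ℂ} {c w : Fin d → ℂ} {r : ℝ}
    (hF : ∀ z ∈ closedBall c r, DifferentiableAt ℂ F z) (hw : w ∈ ball c r) :
    HasSum (fun β : Fin d → ℕ => scaledTaylorCoeff c r β F * ∏ i, ((w i - c i) / r) ^ β i)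
      (F w) := by
  have hr : 0 < r := pos_of_mem_ball hw
  have hFc : ContinuousOn F (closedBall c r) := fun z hz =>
    (hF z hz).continuousAt.continuousWithinAt
  obtain ⟨B, hB⟩ := (isCompact_closedBall c r).exists_bound_of_continuousOn hFc
  have hq : ∀ i, ‖(w i - c i) / (r : ℂ)‖ < 1 := by
    intro i
    rw [norm_div, Complex.norm_real, Real.norm_of_nonneg hr.le, div_lt_one hr, ← dist_eq_norm]
    exact (dist_le_pi_dist w c i).trans_lt hw
  have hqs := (hasSum_pi_prod (fun i => hasSum_geometric_of_norm_lt_one (hq i))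
    (fun i => (summable_geometric_of_lt_one (norm_nonneg _) (hq i)).congr fun k => by
      rw [norm_pow])).2
  have hkey := hasSum_torusIntegral (c := c) (R := fun _ => r)
    (f := fun (β : Fin d → ℕ) ζ => (∏ i, ((w i - c i) / r) ^ β i) *
      ((∏ i, ((r : ℂ) ^ β i * ((ζ i - c i) ^ (β i + 1))⁻¹)) * F ζ))
    (g := fun ζ => (∏ i, (ζ i - w i)⁻¹) * F ζ)
    (b := fun β => ‖∏ i, ((w i - c i) / (r : ℂ)) ^ β i‖ * ((r ^ d)⁻¹ * B))
    (fun β => continuous_const.mul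
      ((continuous_taylorKernel c hr β).mul (continuous_comp_torusMap hr.le hFc)))
    (fun β θ => by
      rw [norm_mul, norm_mul, norm_taylorKernel c hr]
      exact mul_le_mul_of_nonneg_left (mul_le_mul_of_nonneg_left
        (hB _ (torusMap_mem_closedBall c hr.le θ)) (by positivity)) (norm_nonneg _))
    (hqs.mul_right _) (fun θ => by
      set ζ := torusMap c (fun _ => r) θ with hζ
      have hne : ∀ i, ζ i - c i ≠ 0 := torusMap_sub_ne_zero (mem_ball_self hr) θ
      have hlt : ∀ i, ‖(w i - c i) / (ζ i - c i)‖ < 1 := by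
        intro i
        rw [norm_div, hζ, norm_torusMap_sub c hr.le]
        simpa [abs_of_pos hr] using hq i
      have hgeo : ∀ i, HasSum (fun k : ℕ => ((w i - c i) / (ζ i - c i)) ^ k * (ζ i - c i)⁻¹)
          (ζ i - w i)⁻¹ := by
        intro i
        have h := (hasSum_geometric_of_norm_lt_one (hlt i)).mul_right (ζ i - c i)⁻¹
        rwa [← mul_inv, sub_mul, div_mul_cancel₀ _ (hne i), one_mul, sub_sub_sub_cancel_right] at h
      have h1 := (hasSum_pi_prod hgeo fun i =>
        ((summable_geometric_of_lt_one (norm_nonneg _) (hlt i)).mul_right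
          ‖(ζ i - c i)⁻¹‖).congr fun k => by rw [norm_mul, norm_pow]).1
      refine Eq.subst (motive := fun f => HasSum f _) (funext fun β => ?_) (h1.mul_right (F ζ))
      rw [← mul_assoc, ← Finset.prod_mul_distrib]
      congr 1
      refine Finset.prod_congr rfl fun i _ => ?_
      have := hne i
      have hr' : (r : ℂ) ≠ 0 := by exact_mod_cast hr.ne'
      rw [div_pow, div_pow]
      field_simp
      ring)
  rw [torusIntegral_prod_inv_mul hF hw] at hkey
  have hpi : ((2 * π * Complex.I : ℂ) ^ d) ≠ 0 := pow_ne_zero _ Complex.two_pi_I_ne_zero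
  have hfin := hkey.mul_left ((2 * π * Complex.I : ℂ) ^ d)⁻¹
  rw [inv_mul_cancel_left₀ hpi] at hfin
  refine Eq.subst (motive := fun f => HasSum f _) (funext fun β => ?_) hfin
  rw [torusIntegral_const_mul, scaledTaylorCoeff]
  ring

end Polydisc

section Closed

open Metric

variable {d : ℕ}

/-- Cauchy's estimate for the Fréchet derivative, from the one-variable estimate along lines. -/
theorem norm_fderiv_le_of_norm_le {E : Type*} [NormedAddCommGroup E] [NormedSpace ℂ E]
    {F : E → ℂ} {z₀ : E} {r C : ℝ} (hr : 0 < r)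
    (hF : ∀ z ∈ closedBall z₀ r, DifferentiableAt ℂ F z)
    (hC : ∀ z ∈ closedBall z₀ r, ‖F z‖ ≤ C) : ‖fderiv ℂ F z₀‖ ≤ C / r := by
  have hC0 : 0 ≤ C := (norm_nonneg _).trans (hC z₀ (mem_closedBall_self hr.le))
  refine ContinuousLinearMap.opNorm_le_bound _ (by positivity) fun v => ?_
  rcases eq_or_ne v 0 with rfl | hv
  · simp
  have hv' : 0 < ‖v‖ := norm_pos_iff.2 hv
  let γ : ℂ → E := fun t => z₀ + t • v
  have hγ : ∀ t, HasDerivAt γ v t := fun t => by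
    simpa [γ] using! ((hasDerivAt_id t).smul_const v).const_add z₀
  have hmem : ∀ t ∈ closedBall (0 : ℂ) (r / ‖v‖), γ t ∈ closedBall z₀ r := by
    intro t ht
    rw [mem_closedBall_zero_iff, le_div_iff₀ hv'] at ht
    simpa [γ, dist_eq_norm, norm_smul] using ht
  have hd : ∀ t ∈ closedBall (0 : ℂ) (r / ‖v‖), DifferentiableAt ℂ (F ∘ γ) t := fun t ht =>
    (hF _ (hmem t ht)).comp t (hγ t).differentiableAt
  have h0 : HasDerivAt (F ∘ γ) (fderiv ℂ F z₀ v) 0 := by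
    have h1 : HasFDerivAt F (fderiv ℂ F z₀) (γ 0) := by
      simpa [γ] using (hF z₀ (mem_closedBall_self hr.le)).hasFDerivAt
    exact h1.comp_hasDerivAt 0 (hγ 0)
  have h2 := Complex.norm_deriv_le_of_forall_mem_sphere_norm_le (div_pos hr hv')
    (f := F ∘ γ) (c := 0) (C := C) (DifferentiableOn.diffContOnCl fun t ht =>
      (hd t (closure_ball_subset_closedBall ht)).differentiableWithinAt)
    fun t ht => hC _ (hmem t (sphere_subset_closedBall ht))
  rw [h0.deriv] at h2
  refine h2.trans_eq ?_
  field_simp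

/-- A locally uniform limit of holomorphic functions of several variables is holomorphic. -/
theorem differentiableAt_of_tendstoUniformlyOn {E : Type*} [NormedAddCommGroup E] [NormedSpace ℂ E]
    {ι : Type*} {l : Filter ι} [l.NeBot] {G : ι → E → ℂ} {F : E → ℂ} {z₀ : E} {r : ℝ} (hr : 0 < r)
    (hG : ∀ n, ∀ z ∈ closedBall z₀ r, DifferentiableAt ℂ (G n) z)
    (hlim : TendstoUniformlyOn G F l (closedBall z₀ r)) : DifferentiableAt ℂ F z₀ := by
  have hr2 : 0 < r / 2 := half_pos hr
  have hsub : ∀ z ∈ ball z₀ (r / 2), closedBall z (r / 2) ⊆ closedBall z₀ r := by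
    intro z hz
    refine closedBall_subset_closedBall' ?_
    have := mem_ball.1 hz
    linarith
  have hball : ball z₀ (r / 2) ⊆ closedBall z₀ r := fun z hz =>
    hsub z hz (mem_closedBall_self hr2.le)
  have hcauchy : UniformCauchySeqOn (fun n => fderiv ℂ (G n)) l (ball z₀ (r / 2)) := by
    have h1 := hlim.uniformCauchySeqOn
    rw [SeminormedAddGroup.uniformCauchySeqOn_iff_tendstoUniformlyOn_zero,
      Metric.tendstoUniformlyOn_iff] at h1 ⊢
    intro ε hε
    filter_upwards [h1 (ε / 2 * (r / 2)) (by positivity)] with n hn z hz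
    have hn' : ∀ y ∈ closedBall z (r / 2), ‖(G n.1 - G n.2) y‖ ≤ ε / 2 * (r / 2) := by
      intro y hy
      have := hn y (hsub z hz hy)
      simp only [Pi.zero_apply, dist_zero_left, neg_add_eq_sub] at this
      rw [Pi.sub_apply, norm_sub_rev]
      exact this.le
    have h2 := norm_fderiv_le_of_norm_le hr2 (F := G n.1 - G n.2) (fun y hy =>
      (hG n.1 y (hsub z hz hy)).sub (hG n.2 y (hsub z hz hy))) hn'
    rw [mul_div_cancel_right₀ _ hr2.ne', fderiv_sub (hG n.1 z (hball hz)) (hG n.2 z (hball hz))]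
      at h2
    simp only [Pi.zero_apply, dist_zero_left, neg_add_eq_sub]
    rw [norm_sub_rev]
    linarith
  have hpt : ∀ z ∈ ball z₀ (r / 2), ∃ A, Filter.Tendsto (fun n => fderiv ℂ (G n) z) l (𝓝 A) :=
    fun z hz => CompleteSpace.complete (hcauchy.cauchy_map hz)
  choose! G' hG' using hpt
  exact (hasFDerivAt_of_tendstoLocallyUniformlyOn isOpen_ball
    (hcauchy.tendstoUniformlyOn_of_tendsto hG').tendstoLocallyUniformlyOn
    (fun n z hz => (hG n z (hball hz)).hasFDerivAt)
    (fun z hz => hlim.tendsto_at (hball hz)) (mem_ball_self hr2)).differentiableAt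

end Closed

/-! ### Factorization through a Hilbert space -/

section Factorization

variable {E : Type*} [AddCommGroup E] [Module ℂ E]

/-- If `L` is bounded with respect to the norm of `T f` in a Hilbert space `ℓ²(ι)`, then `L` is a
series of rank-one operators whose functionals are the coordinates of `T`. Indeed `L` factors as
`M ∘ T` with `M` defined on the range of `T`; by completeness `M` extends to the closure, and the
orthogonal projection extends it to all of `ℓ²(ι)`, where the unit vectors are available. -/
theorem exists_hasSum_of_isVonNBounded_image [UniformSpace E] [IsUniformAddGroup E]
    [ContinuousSMul ℂ E] [CompleteSpace E] [T2Space E] {ι : Type*}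
    (T : E →ₗ[ℂ] lp (fun _ : ι => ℂ) 2) (L : E →ₗ[ℂ] E) {η : ℝ} (hη : 0 < η)
    (hb : IsVonNBounded ℂ (L '' {f | ‖T f‖ < η})) :
    ∃ f : ι → E, IsVonNBounded ℂ (Set.range f) ∧
      ∀ g : E, HasSum (fun i => (T g) i • f i) (L g) := by
  classical
  have hker : ∀ g, T g = 0 → L g = 0 := by
    intro g hg
    have hmem : ∀ n : ℕ, (n : ℂ) • L g ∈ L '' {f | ‖T f‖ < η} := fun n =>
      ⟨(n : ℂ) • g, by simp [hg, hη], by simp⟩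
    have h1 := hb.smul_tendsto_zero (Filter.Eventually.of_forall hmem)
      (tendsto_inv_atTop_nhds_zero_nat (𝕜 := ℂ))
    refine tendsto_nhds_unique (tendsto_const_nhds.congr' ?_) h1
    filter_upwards [Filter.eventually_ne_atTop 0] with n hn
    have : (n : ℂ) ≠ 0 := by exact_mod_cast hn
    simp [smul_smul, inv_mul_cancel₀ this]
  -- the operator `M` on the range of `T`
  let R : Submodule ℂ (lp (fun _ : ι => ℂ) 2) := LinearMap.range T
  obtain ⟨S, hS⟩ := LinearMap.exists_rightInverse_of_surjective T.rangeRestrict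
    (LinearMap.range_rangeRestrict T)
  have hTS : ∀ x : R, T (S x) = x := fun x => congrArg Subtype.val (LinearMap.congr_fun hS x)
  let M₀ : R →ₗ[ℂ] E := L ∘ₗ S
  have hM₀ : ∀ g, M₀ ⟨T g, LinearMap.mem_range_self T g⟩ = L g := by
    intro g
    have h1 : T (S ⟨T g, LinearMap.mem_range_self T g⟩ - g) = 0 := by
      rw [map_sub, hTS, sub_self]
    have h2 := hker _ h1
    rw [map_sub, sub_eq_zero] at h2
    exact h2
  have hM₀b : ∃ V ∈ 𝓝 (0 : R), IsVonNBounded ℂ (M₀ '' V) := by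
    refine ⟨Metric.ball 0 η, Metric.ball_mem_nhds _ hη, hb.subset ?_⟩
    rintro _ ⟨x, hx, rfl⟩
    refine ⟨S x, ?_, rfl⟩
    rw [mem_ball_zero_iff] at hx
    simpa [hTS] using hx
  let M₁ : R →L[ℂ] E := M₀.clmOfExistsBoundedImage hM₀b
  let e : R →L[ℂ] R.topologicalClosure :=
    R.subtypeL.codRestrict R.topologicalClosure fun x => R.le_topologicalClosure x.2
  have hed : DenseRange e :=
    (denseRange_inclusion_iff (s := (R : Set (lp (fun _ : ι => ℂ) 2)))
      (t := R.topologicalClosure) R.le_topologicalClosure).2 subset_rfl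
  have hei : IsUniformInducing e := by
    have : Isometry e := fun x y => rfl
    exact this.isUniformInducing
  have : CompleteSpace R.topologicalClosure := R.isClosed_topologicalClosure.completeSpace_coe
  let M : lp (fun _ : ι => ℂ) 2 →L[ℂ] E :=
    (M₁.extend e).comp R.topologicalClosure.orthogonalProjectionOnto
  have hM : ∀ g, M (T g) = L g := by
    intro g
    have h1 : R.topologicalClosure.orthogonalProjectionOnto (T g) =
        e ⟨T g, LinearMap.mem_range_self T g⟩ :=
      Submodule.orthogonalProjectionOnto_mem_subspace_eq_self
        (e ⟨T g, LinearMap.mem_range_self T g⟩)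
    change M₁.extend e (R.topologicalClosure.orthogonalProjectionOnto (T g)) = L g
    rw [h1, ContinuousLinearMap.extend_eq _ hed hei]
    exact hM₀ g
  refine ⟨fun i => M (lp.single 2 i (1 : ℂ)), ?_, fun g => ?_⟩
  · have h1 : IsVonNBounded ℂ (Set.range fun i : ι => lp.single 2 i (1 : ℂ) :
        Set (lp (fun _ : ι => ℂ) 2)) := by
      refine (NormedSpace.isVonNBounded_iff' ℂ).2 ⟨1, ?_⟩
      rintro _ ⟨i, rfl⟩
      rw [lp.norm_single (by norm_num)]
      simp
    refine (h1.image M).subset ?_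
    rintro _ ⟨i, rfl⟩
    exact ⟨_, ⟨i, rfl⟩, rfl⟩
  · have h1 := (lp.hasSum_single (by norm_num) (T g)).mapL M
    rw [hM] at h1
    refine Eq.subst (motive := fun f => HasSum f _) (funext fun i => ?_) h1
    rw [← map_smul, ← lp.single_smul, smul_eq_mul, mul_one]

/-- An equicontinuous family of functionals is uniformly bounded on bounded sets. -/
theorem exists_norm_apply_le_of_equicontinuous [TopologicalSpace E] {κ : Type*}
    {φ : κ → E →L[ℂ] ℂ} (hφ : Equicontinuous fun k (g : E) => φ k g) {S : Set E}
    (hS : IsVonNBounded ℂ S) : ∃ B : ℝ, 0 ≤ B ∧ ∀ k, ∀ g ∈ S, ‖φ k g‖ ≤ B := by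
  have h1 : {g : E | ∀ k, ‖φ k g‖ < 1} ∈ 𝓝 (0 : E) := by
    filter_upwards [Metric.equicontinuousAt_iff_right.1 (hφ 0) 1 one_pos] with g hg k
    simpa using hg k
  obtain ⟨ρ, hρ, hab⟩ := (hS h1).exists_pos
  refine ⟨ρ, hρ.le, fun k g hg => ?_⟩
  have hρ' : ‖(ρ : ℂ)‖ = ρ := by rw [Complex.norm_real, Real.norm_of_nonneg hρ.le]
  obtain ⟨x, hx, rfl⟩ := hab (ρ : ℂ) hρ'.ge hg
  have := (hx k).le
  simp only [map_smul, norm_smul, hρ']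
  nlinarith

end Factorization

/-! ### The space of holomorphic functions -/

section HolomorphicSpace

open Metric

/-- The compact convergence uniformity is induced from the additive group of all functions. -/
instance instIsUniformAddGroupContinuousMap {X : Type*} [TopologicalSpace X] :
    IsUniformAddGroup C(X, ℂ) :=
  (ContinuousMap.isUniformEmbedding_toUniformOnFunIsCompact
    (α := X) (β := ℂ)).isUniformInducing.isUniformAddGroup
    (⟨⟨ContinuousMap.toUniformOnFunIsCompact, rfl⟩, fun _ _ => rfl⟩ :
      C(X, ℂ) →+ (UniformOnFun X ℂ {K | IsCompact K}))

variable {d : ℕ} {Ω : Opens (Fin d → ℂ)}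

instance instIsUniformAddGroupHolomorphicSpace : IsUniformAddGroup (HolomorphicSpace Ω) :=
  (HolomorphicSpace Ω).toAddSubgroup.isUniformAddGroup

/-- The extension of a continuous function on `Ω` by zero. -/
noncomputable def extendZero (f : C(Ω, ℂ)) : (Fin d → ℂ) → ℂ :=
  Function.extend (fun z : Ω => (z : Fin d → ℂ)) f 0

theorem extendZero_apply (f : C(Ω, ℂ)) (z : Ω) : extendZero f z = f z :=
  Subtype.val_injective.extend_apply _ _ _

theorem extendZero_apply_of_mem (f : C(Ω, ℂ)) {z : Fin d → ℂ} (hz : z ∈ Ω) :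
    extendZero f z = f ⟨z, hz⟩ :=
  extendZero_apply f ⟨z, hz⟩

theorem extendZero_add (f g : C(Ω, ℂ)) : extendZero (f + g) = extendZero f + extendZero g := by
  have h := Function.extend_add (fun z : Ω => (z : Fin d → ℂ)) f g 0 0
  rw [add_zero] at h
  exact h

theorem extendZero_smul (a : ℂ) (f : C(Ω, ℂ)) : extendZero (a • f) = a • extendZero f := by
  have h := Function.extend_smul a (fun z : Ω => (z : Fin d → ℂ)) f 0
  rw [smul_zero] at h
  exact h

theorem mem_holomorphicSpace_iff {f : C(Ω, ℂ)} :
    f ∈ HolomorphicSpace Ω ↔ ∀ z ∈ Ω, DifferentiableAt ℂ (extendZero f) z := by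
  constructor
  · rintro ⟨F, hF, hfF⟩ z hz
    refine ((hF.differentiableAt (Ω.isOpen.mem_nhds hz))).congr_of_eventuallyEq ?_
    filter_upwards [Ω.isOpen.mem_nhds hz] with y hy
    rw [extendZero_apply_of_mem f hy, hfF]
  · exact fun h => ⟨extendZero f, fun z hz => (h z hz).differentiableWithinAt, fun z =>
      (extendZero_apply f z).symm⟩

theorem isCompact_preimage_val {K : Set (Fin d → ℂ)} (hK : IsCompact K)
    (hKΩ : K ⊆ (Ω : Set (Fin d → ℂ))) : IsCompact ((fun z : Ω => (z : Fin d → ℂ)) ⁻¹' K) :=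
  (Topology.IsInducing.subtypeVal.isCompact_preimage_iff
    (by rw [Subtype.range_coe]; exact hKΩ)).2 hK

theorem isClosed_holomorphicSpace : IsClosed (HolomorphicSpace Ω : Set C(Ω, ℂ)) := by
  refine isClosed_of_closure_subset fun f hf => ?_
  rw [mem_closure_iff_comap_neBot] at hf
  refine mem_holomorphicSpace_iff.2 fun z hz => ?_
  obtain ⟨r, hr, hsub⟩ := nhds_basis_closedBall.mem_iff.1 (Ω.isOpen.mem_nhds hz)
  have hlim := ContinuousMap.tendsto_iff_forall_isCompact_tendstoUniformlyOn.1
    (Filter.tendsto_comap : Filter.Tendsto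
      (Subtype.val : ↑(HolomorphicSpace Ω : Set C(Ω, ℂ)) → C(Ω, ℂ))
      (Filter.comap Subtype.val (𝓝 f)) (𝓝 f)) _
    (isCompact_preimage_val (isCompact_closedBall z r) hsub)
  refine differentiableAt_of_tendstoUniformlyOn hr
    (G := fun g : (HolomorphicSpace Ω : Set C(Ω, ℂ)) => extendZero (g : C(Ω, ℂ)))
    (fun g y hy => mem_holomorphicSpace_iff.1 g.2 y (hsub hy)) ?_
    (l := Filter.comap Subtype.val (𝓝 f))
  intro u hu
  filter_upwards [hlim u hu] with g hg y hy
  rw [extendZero_apply_of_mem _ (hsub hy), extendZero_apply_of_mem _ (hsub hy)]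
  exact hg ⟨y, hsub hy⟩ hy

instance instCompleteSpaceHolomorphicSpace : CompleteSpace (HolomorphicSpace Ω) :=
  isClosed_holomorphicSpace.completeSpace_coe

theorem hasBasis_nhds_zero_holomorphicSpace :
    (𝓝 (0 : HolomorphicSpace Ω)).HasBasis (fun p : Set Ω × ℝ => IsCompact p.1 ∧ 0 < p.2)
      fun p => {f | ∀ z ∈ p.1, ‖(f : C(Ω, ℂ)) z‖ < p.2} := by
  have h1 := (nhds_basis_uniformity' (uniformity_basis_dist (α := ℂ)).compactConvergenceUniformity
    (x := (0 : C(Ω, ℂ)))).comap (Subtype.val : HolomorphicSpace Ω → C(Ω, ℂ))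
  rw [nhds_subtype_eq_comap]
  refine h1.congr (fun _ => Iff.rfl) fun p _ => ?_
  ext f
  simp [UniformSpace.ball]

/-- The scaled Taylor coefficient as a linear functional on `𝓗(Ω)`. -/
noncomputable def taylorFunctional {c : Fin d → ℂ} {r : ℝ} (hr : 0 < r)
    (hc : closedBall c r ⊆ (Ω : Set (Fin d → ℂ))) (β : Fin d → ℕ) :
    HolomorphicSpace Ω →ₗ[ℂ] ℂ where
  toFun f := scaledTaylorCoeff c r β (extendZero (f : C(Ω, ℂ)))
  map_add' f g := by
    have h : ∀ f : HolomorphicSpace Ω, ContinuousOn (extendZero (f : C(Ω, ℂ))) (closedBall c r) :=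
      fun f z hz => (mem_holomorphicSpace_iff.1 f.2 z (hc hz)).continuousAt.continuousWithinAt
    rw [Submodule.coe_add, extendZero_add, scaledTaylorCoeff_add hr β (h f) (h g)]
  map_smul' a f := by
    rw [Submodule.coe_smul, extendZero_smul, scaledTaylorCoeff_smul]
    rfl

/-- Functionals bounded by the sup norm over a common compact set are equicontinuous. -/
theorem equicontinuous_of_norm_le {κ : Type*} {φ : κ → HolomorphicSpace Ω →ₗ[ℂ] ℂ} {K : Set Ω}
    (hK : IsCompact K) (hφ : ∀ k (f : HolomorphicSpace Ω) (B : ℝ),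
      (∀ z ∈ K, ‖(f : C(Ω, ℂ)) z‖ ≤ B) → ‖φ k f‖ ≤ B) :
    Equicontinuous fun k (f : HolomorphicSpace Ω) => φ k f := by
  refine equicontinuous_of_equicontinuousAt_zero φ ?_
  rw [Metric.equicontinuousAt_iff_right]
  intro ε hε
  filter_upwards [hasBasis_nhds_zero_holomorphicSpace.mem_of_mem
    (i := (K, ε / 2)) ⟨hK, half_pos hε⟩] with f hf k
  have := hφ k f (ε / 2) fun z hz => (hf z hz).le
  simp only [Function.comp_apply, map_zero, dist_zero_left]
  linarith

end HolomorphicSpace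

/-! ### Enumerating the weights -/

section Weights

variable {d : ℕ}

theorem summable_half_pow_sum : Summable fun β : Fin d → ℕ => (1 / 2 : ℝ) ^ ∑ i, β i := by
  have h := (hasSum_pi_prod (d := d) (g := fun _ k => (1 / 2 : ℂ) ^ k) (a := fun _ => 2)
    (fun _ => by
      have := hasSum_geometric_of_norm_lt_one (ξ := (1 / 2 : ℂ)) (by norm_num)
      norm_num at this ⊢
      exact this)
    fun _ => (summable_geometric_of_lt_one (r := 1 / 2) (by norm_num) (by norm_num)).congr
      fun k => by simp).2
  refine h.congr fun β => ?_
  simp [Finset.prod_pow_eq_pow_sum]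

theorem ncard_sum_le (J : Type*) [Fintype J] (m : ℕ) :
    {x : J × (Fin d → ℕ) | ∑ i, x.2 i ≤ m}.Finite ∧
      {x : J × (Fin d → ℕ) | ∑ i, x.2 i ≤ m}.ncard ≤ Fintype.card J * (m + 1) ^ d := by
  classical
  let F : Finset (J × (Fin d → ℕ)) :=
    Finset.univ ×ˢ Fintype.piFinset fun _ : Fin d => Finset.range (m + 1)
  have hsub : {x : J × (Fin d → ℕ) | ∑ i, x.2 i ≤ m} ⊆ F := by
    rintro ⟨j, β⟩ hx
    simp only [F, Finset.coe_product, Finset.coe_univ, Set.mem_prod, Set.mem_univ, true_and,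
      Finset.mem_coe, Fintype.mem_piFinset, Finset.mem_range]
    exact fun i => Nat.lt_succ_of_le ((Finset.single_le_sum (fun i _ => Nat.zero_le (β i))
      (Finset.mem_univ i)).trans hx)
  refine ⟨F.finite_toSet.subset hsub, ?_⟩
  have h := Set.ncard_le_ncard hsub F.finite_toSet
  rw [Set.ncard_coe_finset] at h
  simpa [F] using h

/-- The weights `2 ^ (-|β|)`, for finitely many copies of the multi-indices `β ∈ ℕ^d`, can be
enumerated so that they decay like `exp (-a * k ^ (1 / d))`: at most a constant times `(m + 1) ^ d`
indices have `|β| ≤ m`. -/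
theorem exists_enumeration_half_pow_sum (hd : 1 ≤ d) (J : Type*) [Fintype J] :
    ∃ (r : J × (Fin d → ℕ) → ℕ) (a : ℝ), Function.Injective r ∧ 0 < a ∧ a ≤ 1 ∧
      ∀ x, (1 / 2 : ℝ) ^ ∑ i, x.2 i ≤
        2 * Real.exp (-a * ((r x : ℝ) + 1) ^ (1 / (d : ℝ))) := by
  have hset : ∀ x : J × (Fin d → ℕ), {y : J × (Fin d → ℕ) |
      (1 / 2 : ℝ) ^ ∑ i, x.2 i ≤ (1 / 2 : ℝ) ^ ∑ i, y.2 i} = {y | ∑ i, y.2 i ≤ ∑ i, x.2 i} := by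
    intro x
    ext y
    exact pow_le_pow_iff_right_of_lt_one₀ (a := (1 / 2 : ℝ)) (by norm_num) (by norm_num)
  obtain ⟨r, hinj, -, -, hr⟩ := exists_decreasing_rank
    (fun x : J × (Fin d → ℕ) => (1 / 2 : ℝ) ^ ∑ i, x.2 i)
    (fun x => by rw [hset]; exact (ncard_sum_le J _).1)
  set N : ℕ := Fintype.card J + 1 with hN
  have hN1 : (1 : ℝ) ≤ N := by
    rw [hN]; push_cast; linarith [Nat.cast_nonneg (α := ℝ) (Fintype.card J)]
  have hlog : 0 < Real.log 2 := Real.log_pos one_lt_two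
  have hd' : (1 : ℝ) ≤ d := by exact_mod_cast hd
  refine ⟨r, Real.log 2 / N, hinj, by positivity, ?_, fun x => ?_⟩
  · rw [div_le_one (by positivity)]
    linarith [Real.log_two_lt_d9]
  set m := ∑ i, x.2 i with hm
  have h1 : r x + 1 ≤ N * (m + 1) ^ d := by
    have h2 := hr x
    rw [hset, ← hm] at h2
    have h3 := (ncard_sum_le (d := d) J m).2
    have h4 : Fintype.card J * (m + 1) ^ d ≤ N * (m + 1) ^ d := Nat.mul_le_mul_right _ (by omega)
    omega
  have h2 : ((r x : ℝ) + 1) ^ (1 / (d : ℝ)) ≤ N * ((m : ℝ) + 1) := by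
    have h3 : (r x : ℝ) + 1 ≤ ((N : ℝ) * ((m : ℝ) + 1)) ^ d := by
      have h4 : (r x : ℝ) + 1 ≤ (N : ℝ) * ((m : ℝ) + 1) ^ d := by exact_mod_cast h1
      refine h4.trans ?_
      rw [mul_pow]
      exact mul_le_mul_of_nonneg_right (le_self_pow₀ hN1 (by omega)) (by positivity)
    calc ((r x : ℝ) + 1) ^ (1 / (d : ℝ))
        ≤ (((N : ℝ) * ((m : ℝ) + 1)) ^ d) ^ (1 / (d : ℝ)) :=
          Real.rpow_le_rpow (by positivity) h3 (by positivity)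
      _ = N * ((m : ℝ) + 1) := by
          rw [one_div, Real.pow_rpow_inv_natCast (by positivity) (by omega)]
  have h3 : (1 / 2 : ℝ) ^ m = 2 * Real.exp (-(Real.log 2) * ((m : ℝ) + 1)) := by
    have h4 : Real.exp (-(Real.log 2) * ((m : ℝ) + 1)) = (1 / 2 : ℝ) ^ (m + 1) := by
      rw [mul_comm, ← Nat.cast_succ, Real.exp_nat_mul, Real.exp_neg, Real.exp_log two_pos, one_div]
    rw [h4, pow_succ]
    ring
  rw [h3]
  refine mul_le_mul_of_nonneg_left (Real.exp_le_exp.2 ?_) two_pos.le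
  rw [neg_mul, neg_mul, neg_le_neg_iff, div_mul_eq_mul_div, div_le_iff₀ (by positivity), mul_assoc]
  exact mul_le_mul_of_nonneg_left (h2.trans_eq (mul_comm _ _)) hlog.le

end Weights

/-! ### Series representation and eigenvalues -/

section Expansion

open Metric

variable {d : ℕ} {Ω : Opens (Fin d → ℂ)}

/-- The series representation over the index set of the Taylor coefficients at finitely many
points, whose polydiscs cover a compact set on which functions are small near `0`. The Taylor
coefficients are bounded on a larger polydisc, which leaves room for the weights `2 ^ (-|β|)`
twice: once for the coefficients of the series, once to recover the sup norm from `ℓ²`. -/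
theorem exists_hasSum_taylorFunctional (L : HolomorphicSpace Ω →ₗ[ℂ] HolomorphicSpace Ω)
    (hL : IsBoundedOperator (E := HolomorphicSpace Ω) L) :
    ∃ (t : Finset (Fin d → ℂ)) (φ : t × (Fin d → ℕ) → HolomorphicSpace Ω →L[ℂ] ℂ)
      (f : t × (Fin d → ℕ) → HolomorphicSpace Ω),
      Equicontinuous (fun k (g : HolomorphicSpace Ω) => φ k g) ∧
      IsVonNBounded ℂ (Set.range f) ∧
      ∀ g : HolomorphicSpace Ω,
        HasSum (fun x => (((1 / 2 : ℝ) ^ ∑ i, x.2 i : ℝ) * φ x g : ℂ) • f x) (L g) := by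
  classical
  obtain ⟨U, hU, hLU⟩ := hL
  obtain ⟨⟨K, ε⟩, ⟨hK, hε⟩, hKU⟩ := hasBasis_nhds_zero_holomorphicSpace.mem_iff.1 hU
  simp only at hK hε hKU
  let K' : Set (Fin d → ℂ) := (fun z : Ω => (z : Fin d → ℂ)) '' K
  have hK' : IsCompact K' := hK.image continuous_subtype_val
  have hK'Ω : K' ⊆ (Ω : Set (Fin d → ℂ)) := by rintro _ ⟨z, -, rfl⟩; exact z.2
  obtain ⟨r, hr, hrΩ⟩ := hK'.exists_cthickening_subset_open Ω.isOpen hK'Ω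
  obtain ⟨t', ht'K, ht'fin, hcover⟩ := hK'.finite_cover_balls (e := r / 4) (by positivity)
  lift t' to Finset (Fin d → ℂ) using ht'fin with t
  have hball : ∀ c ∈ t, closedBall c r ⊆ cthickening r K' := fun c hc =>
    closedBall_subset_cthickening (ht'K hc) r
  have hballΩ : ∀ c ∈ t, closedBall c r ⊆ (Ω : Set (Fin d → ℂ)) := fun c hc =>
    (hball c hc).trans hrΩ
  let φ : t × (Fin d → ℕ) → HolomorphicSpace Ω →ₗ[ℂ] ℂ := fun x =>
    taylorFunctional hr (hballΩ x.1 x.1.2) x.2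
  let K₂ : Set Ω := (fun z : Ω => (z : Fin d → ℂ)) ⁻¹' cthickening r K'
  have hK₂ : IsCompact K₂ := isCompact_preimage_val hK'.cthickening hrΩ
  have hφ : ∀ x (f : HolomorphicSpace Ω) (B : ℝ), (∀ z ∈ K₂, ‖(f : C(Ω, ℂ)) z‖ ≤ B) →
      ‖φ x f‖ ≤ B := by
    intro x f B hB
    refine norm_scaledTaylorCoeff_le hr x.2 fun z hz => ?_
    rw [extendZero_apply_of_mem _ (hballΩ x.1 x.1.2 hz)]
    exact hB _ (hball x.1 x.1.2 hz)
  have hequi : Equicontinuous fun x (f : HolomorphicSpace Ω) => φ x f :=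
    equicontinuous_of_norm_le hK₂ hφ
  -- the weights and their summability
  let σ : t × (Fin d → ℕ) → ℝ := fun x => (1 / 2 : ℝ) ^ ∑ i, x.2 i
  have hσ0 : ∀ x, 0 ≤ σ x := fun x => by positivity
  have hσ1 : ∀ x, σ x ≤ 1 := fun x => pow_le_one₀ (by norm_num) (by norm_num)
  have hσs : Summable σ := by
    have h := Summable.mul_of_nonneg (f := fun _ : t => (1 : ℝ))
      (g := fun β : Fin d → ℕ => (1 / 2 : ℝ) ^ ∑ i, β i) (Summable.of_finite) summable_half_pow_sum
      (fun _ => zero_le_one) (fun _ => by positivity)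
    simpa [σ] using h
  have hmem : ∀ f : HolomorphicSpace Ω,
      Memℓp (E := fun _ : t × (Fin d → ℕ) => ℂ) (fun x => (σ x : ℂ) * φ x f) 2 := by
    intro f
    obtain ⟨B, hB⟩ := hK₂.exists_bound_of_continuousOn (f : C(Ω, ℂ)).continuous.continuousOn
    refine memℓp_gen (Summable.of_nonneg_of_le (fun x => by positivity) (fun x => ?_)
      (hσs.mul_left (B ^ 2)))
    have h1 := hφ x f B hB
    have h2 : ‖φ x f‖ ^ 2 ≤ B ^ 2 := pow_le_pow_left₀ (norm_nonneg _) h1 2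
    have h3 : ‖(σ x : ℂ) * φ x f‖ = σ x * ‖φ x f‖ := by
      rw [norm_mul, Complex.norm_real, Real.norm_of_nonneg (hσ0 x)]
    rw [h3]
    norm_num
    rw [mul_pow, mul_comm]
    refine mul_le_mul h2 ?_ (by have := hσ0 x; positivity) (by positivity)
    nlinarith [hσ0 x, hσ1 x]
  let T : HolomorphicSpace Ω →ₗ[ℂ] lp (fun _ : t × (Fin d → ℕ) => ℂ) 2 :=
    { toFun := fun f => ⟨fun x => (σ x : ℂ) * φ x f, hmem f⟩
      map_add' := fun f g => by
        ext x
        simp only [map_add, mul_add]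
        rfl
      map_smul' := fun a f => by
        ext x
        simp [mul_left_comm] }
  have hT : ∀ f x, T f x = (σ x : ℂ) * φ x f := fun f x => rfl
  -- the sup norm on `K` is controlled by the norm of `T f`
  set S : ℝ := ∑' β : Fin d → ℕ, (1 / 2 : ℝ) ^ ∑ i, β i with hS
  have hS0 : 0 ≤ S := tsum_nonneg fun β => by positivity
  have hbound : ∀ (f : HolomorphicSpace Ω), ∀ z ∈ K, ‖(f : C(Ω, ℂ)) z‖ ≤ S * ‖T f‖ := by
    intro f z hz
    obtain ⟨c, hct, hzc⟩ := Set.mem_iUnion₂.1 (hcover ⟨z, hz, rfl⟩)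
    have hsum := hasSum_scaledTaylorCoeff (fun y hy =>
      mem_holomorphicSpace_iff.1 f.2 y (hballΩ c hct hy))
      (ball_subset_ball (by linarith) hzc : (z : Fin d → ℂ) ∈ ball c r)
    rw [extendZero_apply] at hsum
    rw [← hsum.tsum_eq, hS, ← tsum_mul_right]
    refine tsum_of_norm_bounded (summable_half_pow_sum.mul_right _).hasSum fun β => ?_
    have h1 : ‖(T f) (⟨c, hct⟩, β)‖ ≤ ‖T f‖ := lp.norm_apply_le_norm (by norm_num) _ _
    rw [hT, norm_mul, Complex.norm_real, Real.norm_of_nonneg (hσ0 _)] at h1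
    have h2 : ‖∏ i, (((z : Fin d → ℂ) i - c i) / (r : ℂ)) ^ β i‖ ≤
        (1 / 2 : ℝ) ^ (∑ i, β i) * (1 / 2 : ℝ) ^ ∑ i, β i := by
      rw [← mul_pow, ← Finset.prod_pow_eq_pow_sum, norm_prod]
      refine Finset.prod_le_prod (fun _ _ => norm_nonneg _) fun i _ => ?_
      rw [norm_pow]
      refine pow_le_pow_left₀ (norm_nonneg _) ?_ _
      rw [norm_div, Complex.norm_real, Real.norm_of_nonneg hr.le, div_le_iff₀ hr, ← dist_eq_norm]
      have := (dist_le_pi_dist (z : Fin d → ℂ) c i).trans hzc.le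
      linarith
    rw [norm_mul]
    calc ‖scaledTaylorCoeff c r β (extendZero (f : C(Ω, ℂ)))‖ *
          ‖∏ i, (((z : Fin d → ℂ) i - c i) / (r : ℂ)) ^ β i‖
        ≤ ‖φ (⟨c, hct⟩, β) f‖ * ((1 / 2 : ℝ) ^ (∑ i, β i) * (1 / 2 : ℝ) ^ ∑ i, β i) :=
          mul_le_mul_of_nonneg_left h2 (norm_nonneg _)
      _ = (1 / 2 : ℝ) ^ (∑ i, β i) * (σ (⟨c, hct⟩, β) * ‖φ (⟨c, hct⟩, β) f‖) := by
          simp only [σ]; ring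
      _ ≤ (1 / 2 : ℝ) ^ (∑ i, β i) * ‖T f‖ := mul_le_mul_of_nonneg_left h1 (by positivity)
  have hη : 0 < ε / (S + 1) := by positivity
  obtain ⟨f, hf, hsum⟩ := exists_hasSum_of_isVonNBounded_image T L hη (hLU.subset (by
    rintro _ ⟨g, hg, rfl⟩
    refine ⟨g, hKU fun z hz => (hbound g z hz).trans_lt ?_, rfl⟩
    have hg' : ‖T g‖ < ε / (S + 1) := hg
    rw [lt_div_iff₀ (by positivity)] at hg'
    nlinarith [norm_nonneg (T g)]))
  exact ⟨t, fun x => ⟨φ x, hequi.continuous x⟩, f, hequi, hf, hsum⟩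

/-- The series representation, enumerated. -/
theorem exists_hasSum_exp (hd : 1 ≤ d) (L : HolomorphicSpace Ω →ₗ[ℂ] HolomorphicSpace Ω)
    (hL : IsBoundedOperator (E := HolomorphicSpace Ω) L) :
    ∃ (s : ℕ → ℝ) (φ : ℕ → HolomorphicSpace Ω →L[ℂ] ℂ) (f : ℕ → HolomorphicSpace Ω) (a : ℝ),
      0 < a ∧ (∀ k, 0 < s k) ∧
      (∀ k, s k ≤ 2 * Real.exp (-a * ((k : ℝ) + 1) ^ (1 / (d : ℝ)))) ∧
      Equicontinuous (fun k (g : HolomorphicSpace Ω) => φ k g) ∧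
      IsVonNBounded ℂ (Set.range f) ∧
      ∀ g : HolomorphicSpace Ω, HasSum (fun k => ((s k : ℂ) * φ k g) • f k) (L g) := by
  classical
  obtain ⟨t, ψ, h, hψ, hh, hsum⟩ := exists_hasSum_taylorFunctional L hL
  obtain ⟨r, a, hr, ha, ha1, hdecay⟩ := exists_enumeration_half_pow_sum hd t
  -- terms outside the range of the enumeration are zero, with a harmless positive coefficient
  let s : ℕ → ℝ := Function.extend r (fun x => (1 / 2 : ℝ) ^ ∑ i, x.2 i)
    fun k => Real.exp (-((k : ℝ) + 1) ^ (1 / (d : ℝ)))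
  let φ : ℕ → HolomorphicSpace Ω →L[ℂ] ℂ := Function.extend r ψ 0
  let f : ℕ → HolomorphicSpace Ω := Function.extend r h 0
  have hs : ∀ x, s (r x) = (1 / 2 : ℝ) ^ ∑ i, x.2 i := fun x => hr.extend_apply _ _ x
  have hφ : ∀ x, φ (r x) = ψ x := fun x => hr.extend_apply _ _ x
  have hf : ∀ x, f (r x) = h x := fun x => hr.extend_apply _ _ x
  have hs' : ∀ k, k ∉ Set.range r → s k = Real.exp (-((k : ℝ) + 1) ^ (1 / (d : ℝ))) :=
    fun k hk => Function.extend_apply' _ _ _ hk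
  have hφ' : ∀ k, k ∉ Set.range r → φ k = 0 := fun k hk => Function.extend_apply' _ _ _ hk
  have hf' : ∀ k, k ∉ Set.range r → f k = 0 := fun k hk => Function.extend_apply' _ _ _ hk
  refine ⟨s, φ, f, a, ha, fun k => ?_, fun k => ?_, ?_, ?_, fun g => ?_⟩
  · by_cases hk : k ∈ Set.range r
    · obtain ⟨x, rfl⟩ := hk
      rw [hs]; positivity
    · rw [hs' k hk]; positivity
  · by_cases hk : k ∈ Set.range r
    · obtain ⟨x, rfl⟩ := hk
      rw [hs]; exact hdecay x
    · rw [hs' k hk]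
      have h1 : 0 ≤ ((k : ℝ) + 1) ^ (1 / (d : ℝ)) := by positivity
      have h2 : Real.exp (-((k : ℝ) + 1) ^ (1 / (d : ℝ))) ≤
          Real.exp (-a * ((k : ℝ) + 1) ^ (1 / (d : ℝ))) := Real.exp_le_exp.2 (by nlinarith)
      have h3 := Real.exp_pos (-a * ((k : ℝ) + 1) ^ (1 / (d : ℝ)))
      linarith
  · intro g₀ u hu
    filter_upwards [hψ g₀ u hu] with g hg k
    by_cases hk : k ∈ Set.range r
    · obtain ⟨x, rfl⟩ := hk
      simpa only [hφ] using hg x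
    · rw [hφ' k hk]
      exact refl_mem_uniformity (x := (0 : ℂ)) hu
  · refine (hh.union (isVonNBounded_singleton (0 : HolomorphicSpace Ω))).subset ?_
    rintro _ ⟨k, rfl⟩
    by_cases hk : k ∈ Set.range r
    · obtain ⟨x, rfl⟩ := hk
      exact Or.inl ⟨x, (hf x).symm⟩
    · exact Or.inr (hf' k hk)
  · refine (hr.hasSum_iff fun k hk => ?_).1 ?_
    · rw [hf' k hk, smul_zero]
    · refine Eq.subst (motive := fun F => HasSum F _) (funext fun x => ?_) (hsum g)
      simp only [Function.comp_apply, hs, hφ, hf]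

end Expansion

/-- A series of rank-one operators with a bounded sequence of vectors, an equicontinuous sequence of
functionals and coefficients of size `exp (-a * k ^ α)` has an eigenvalue sequence, and every such
sequence is in `𝓔(α)`. -/
theorem eigenvalues_of_hasSum_exp {E : Type*} [AddCommGroup E] [Module ℂ E] [TopologicalSpace E]
    [IsTopologicalAddGroup E] [ContinuousSMul ℂ E] [T2Space E] {L : E →ₗ[ℂ] E} {s : ℕ → ℝ}
    {φ : ℕ → E →L[ℂ] ℂ} {f : ℕ → E} {a α : ℝ} (ha : 0 < a) (hα0 : 0 < α) (hα1 : α ≤ 1)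
    (hs0 : ∀ k, 0 < s k) (hs : ∀ k, s k ≤ 2 * Real.exp (-a * ((k : ℝ) + 1) ^ α))
    (hφ : Equicontinuous fun k (g : E) => φ k g) (hf : IsVonNBounded ℂ (Set.range f))
    (hsum : ∀ g : E, HasSum (fun k => ((s k : ℂ) * φ k g) • f k) (L g)) :
    (∃ ev : ℕ → ℂ, IsEigenvalueSequence L ev) ∧
      ∀ ev : ℕ → ℂ, IsEigenvalueSequence L ev → ev ∈ ExpClass α := by
  obtain ⟨B, hB0, hB⟩ := exists_norm_apply_le_of_equicontinuous hφ hf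
  have hnorm : ∀ k, ‖(s k : ℂ)‖ = s k := fun k => by
    rw [Complex.norm_real, Real.norm_of_nonneg (hs0 k).le]
  have hC : 0 ≤ 2 * B := by positivity
  -- the coefficients `⟨f l, φ k⟩` are bounded, uniformly in `k` and `l`
  have hw : ∀ k l, ‖(s l : ℂ) * φ k (f l)‖ ≤
      2 * B * Real.exp (-a * ((l : ℝ) + 1) ^ α) := by
    intro k l
    rw [norm_mul, hnorm]
    have h1 := mul_le_mul (hs l) (hB k (f l) ⟨l, rfl⟩) (norm_nonneg _) (by positivity)
    linarith
  have hφsum : ∀ k g, HasSum (fun l => (s l : ℂ) * φ k (f l) * φ l g) (φ k (L g)) := by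
    intro k g
    have h1 := (hsum g).mapL (φ k)
    refine Eq.subst (motive := fun F => HasSum F _) (funext fun l => ?_) h1
    rw [map_smul, smul_eq_mul]
    exact mul_right_comm _ _ _
  have hbdd : ∀ g : E, ∃ b : ℝ, ∀ k, ‖φ k g‖ ≤ b := by
    intro g
    obtain ⟨b, -, hb⟩ := exists_norm_apply_le_of_equicontinuous
      hφ (isVonNBounded_singleton (𝕜 := ℂ) g)
    exact ⟨b, fun k => hb k g rfl⟩
  have hsep : ∀ g : E, (∀ k, φ k g = 0) → L g = 0 := by
    intro g h0
    have h1 := hsum g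
    simp only [h0, mul_zero, zero_smul] at h1
    exact h1.unique hasSum_zero
  have hsmall := hasSmallEigenvalues_of_hasSum L (fun k => (φ k).toLinearMap)
    (fun k l => (s l : ℂ) * φ k (f l)) hC ha hα0 hα1 hw hφsum hbdd hsep
  have ha4 : 0 < a / 4 := by positivity
  exact ⟨hsmall.exists_isEigenvalueSequence ha4 hα0, fun ev hev => hsmall.mem_expClass
    (mul_nonneg hC (tsum_nonneg fun _ => (Real.exp_pos _).le)) ha4 hα0 hev⟩

theorem theorem7p1 (d : ℕ) (hd : 1 ≤ d) (Ω : Opens (Fin d → ℂ))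
    (L : HolomorphicSpace Ω →ₗ[ℂ] HolomorphicSpace Ω)
    (hL : IsBoundedOperator (E := HolomorphicSpace Ω) L) :
    (∃ (s : ℕ → ℝ) (f' : ℕ → HolomorphicSpace Ω →L[ℂ] ℂ) (f : ℕ → HolomorphicSpace Ω),
      (∀ k, 0 < s k) ∧
      (fun k => (s k : ℂ)) ∈ ExpClass (1 / (d : ℝ)) ∧
      Equicontinuous (fun k (g : HolomorphicSpace Ω) => f' k g) ∧
      IsVonNBounded ℂ (Set.range f) ∧
      ∀ g : HolomorphicSpace Ω, HasSum (fun k => ((s k : ℂ) * f' k g) • f k) (L g)) ∧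
    (∃ ev : ℕ → ℂ, IsEigenvalueSequence (E := HolomorphicSpace Ω) L ev) ∧
    (∀ ev : ℕ → ℂ, IsEigenvalueSequence (E := HolomorphicSpace Ω) L ev →
      ev ∈ ExpClass (1 / (d : ℝ))) := by
  obtain ⟨s, φ, f, a, ha, hs0, hs, hφ, hf, hsum⟩ := exists_hasSum_exp hd L hL
  have hd' : (1 : ℝ) ≤ d := by exact_mod_cast hd
  have hα0 : 0 < 1 / (d : ℝ) := by positivity
  have hα1 : 1 / (d : ℝ) ≤ 1 := by rw [div_le_one (by positivity)]; exact hd'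
  refine ⟨⟨s, φ, f, hs0, ?_, hφ, hf, hsum⟩, ?_⟩
  · refine Set.mem_biUnion (show a ∈ Set.Ioi (0 : ℝ) from ha) ⟨2, ?_⟩
    rintro _ ⟨k, rfl⟩
    have h1 := hs k
    simp only
    rw [Complex.norm_real, Real.norm_of_nonneg (hs0 k).le]
    rwa [neg_mul, Real.exp_neg, ← div_eq_mul_inv, le_div_iff₀ (Real.exp_pos _)] at h1
  -- abstracting over `hsum` keeps the unification of the instances on the subspace cheap
  · have key := fun hsum => eigenvalues_of_hasSum_exp (E := HolomorphicSpace Ω) (L := L) (s := s)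
      (φ := φ) (f := f) ha hα0 hα1 hs0 hs hφ hf hsum
    exact key hsum
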